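/- Let $n,k\ge 0$ be integers with $k+1\le n$, let $x=(x_1,\dots,x_{n-k-1})\in\mathbb{C}^{n-k-1}$ with $|x_i|<1$ for all $i$, let $t\in\mathbb{C}$, and let $\epsilon_1,\dots,\epsilon_{k+1}>0$ be real numbers with $|t|(1+\epsilon_i)<1$ for all $i$ (for $t\neq 0$ this says $\epsilon_i<|t^{-1}|-1$). For partitions $\lambda,\mu$ let $$s_{\lambda/\mu}(x_1,\dots,x_l)=\sum_{T}x^T$$ be the skew Schur function, the sum being over all semistandard Young tableaux $T$ of shape $\lambda/\mu$ with entries in $\{1,\dots,l\}$ (weakly increasing along rows, strictly increasing down columns; $x^T=\prod_{c}x_{T(c)}$ over the boxes $c$ of $\lambda/\mu$; so $s_{\lambda/\mu}=0$ unless $\mu\subseteq\lambda$), and let $\ell(\lambda)$ be the number of parts of $\lambda$. Then the series $$S_{n,k}(x;t)=\sum_{\lambda,\mu\,:\,\ell(\lambda)\le n,\ \ell(\mu)\le k+1}s_{\lambda/\mu}(x_1,\dots,x_{n-k-1})\,t^{|\mu|}$$ converges absolutely, and $$S_{n,k}(x;t)=\frac{(-1)^{\binom{k+1}{2}}}{(k+1)!}\prod_{i=1}^{n-k-1}\frac{1}{1-x_i}\prod_{1\le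 i<j\le n-k-1}\frac{1}{1-x_ix_j}\cdot\frac{1}{(2\pi \mathrm{i})^{k+1}}\int_T F(y)\,dy_1\cdots dy_{k+1},$$ where $$F(y)=\prod_{1\le i<j\le k+1}\frac{(y_i-y_j)^2}{1-t^2y_iy_j}\ \prod_{i=1}^{n-k-1}\prod_{j=1}^{k+1}\frac{1}{1-x_ity_j}\ \prod_{i=1}^{k+1}\frac{1}{1-ty_i}\ \prod_{i=1}^{k+1}\frac{1}{y_i-1}\ \prod_{1\le i<j\le k+1}\frac{1}{y_iy_j-1}$$ and $T=C_1\times\cdots\times C_{k+1}$, where $C_i=\{z\in\mathbb{C}:|z|=1+\epsilon_i\}$ is positively oriented and $\mathrm{i}=\sqrt{-1}$; $F$ is integrable on $T$. -/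

import Mathlib

open scoped BigOperators

/-- The cells of the skew diagram `lam / mu`. -/
abbrev SkewCell (lam mu : YoungDiagram) : Type :=
  {c : ℕ × ℕ // c ∈ lam.cells \ mu.cells}

/-- A semistandard Young tableau of skew shape `lam / mu` (which presupposes `mu ⊆ lam`) with
entries in an alphabet of `l` letters: weakly increasing along rows, strictly increasing down
columns. The cell `(i, j)` lies in row `i` and column `j`. -/
def IsSkewSSYT {lam mu : YoungDiagram} {l : ℕ} (T : SkewCell lam mu → Fin l) : Prop :=
  mu ≤ lam ∧
  (∀ c d : SkewCell lam mu, c.1.1 = d.1.1 → c.1.2 < d.1.2 → T c ≤ T d) ∧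
  (∀ c d : SkewCell lam mu, c.1.2 = d.1.2 → c.1.1 < d.1.1 → T c < T d)

open Classical in
/-- The skew Schur function `s_{lam/mu}(x_1, …, x_l)`, the sum of the monomials `x^T` over all
semistandard tableaux `T` of shape `lam / mu` with entries in `1, …, l`
(zero when `mu` is not contained in `lam`, as there are no such tableaux). -/
noncomputable def skewSchur (lam mu : YoungDiagram) {l : ℕ} (x : Fin l → ℂ) : ℂ :=
  ∑ T : SkewCell lam mu → Fin l with IsSkewSSYT T, ∏ c, x (T c)

/-- The number of (nonzero) parts of a partition, i.e. of rows of its diagram. -/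
def partLength (lam : YoungDiagram) : ℕ := lam.colLen 0

/-- Pairs of partitions `(lam, mu)` with `ℓ(lam) ≤ n` and `ℓ(mu) ≤ k + 1`. -/
abbrev PartPair (n k : ℕ) : Type :=
  {p : YoungDiagram × YoungDiagram // partLength p.1 ≤ n ∧ partLength p.2 ≤ k + 1}

/-- The summand `s_{lam/mu}(x_1, …, x_{n-k-1}) t^{|mu|}`. -/
noncomputable def schurTerm (n k : ℕ) (x : Fin (n - k - 1) → ℂ) (t : ℂ) (p : PartPair n k) : ℂ :=
  skewSchur p.1.1 p.1.2 x * t ^ p.1.2.card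

/-- `S_{n,k}(x; t)`. -/
noncomputable def schurSum (n k : ℕ) (x : Fin (n - k - 1) → ℂ) (t : ℂ) : ℂ :=
  ∑' p : PartPair n k, schurTerm n k x t p

/-- The integrand, a rational function of `y = (y_1, …, y_p)`. -/
noncomputable def torusIntegrand {m p : ℕ} (x : Fin m → ℂ) (t : ℂ) (y : Fin p → ℂ) : ℂ :=
  (∏ i, ∏ j ∈ Finset.Ioi i, (y i - y j) ^ 2 / (1 - t ^ 2 * y i * y j)) *
  (∏ i, ∏ j, 1 / (1 - x i * t * y j)) *
  (∏ i, 1 / (1 - t * y i)) *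
  (∏ i, 1 / (y i - 1)) *
  (∏ i, ∏ j ∈ Finset.Ioi i, 1 / (y i * y j - 1))

/-!
For partitions `μ` with at most `q = k + 1` parts let `a_μ(y) = det (y_i ^ (μ_j + q - j))` be the
alternants. Removing the cells with the smallest letter from a tableau removes a horizontal strip,
and horizontal strips act on alternants in two ways: adding strips is multiplication by
`∏ (1 - x z_i)⁻¹` (Pieri), while removing strips introduces a new variable,
`a_κ(x, z) = ∏ (x - z_i) ∑_μ x ^ |κ / μ| a_μ(z)` (branching).

Both when a strip is added to `λ` and when one is removed from it, the parts range independently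
over the intervals `[λ_{i+1}, λ_i]`, except that an added strip also lengthens the first part
arbitrarily. So the added strips have `(1 - x)⁻¹` times the generating function of the removed
ones, which gives Littlewood's identity
`∑_ν a_ν(z) = ∏ (1 - z_i)⁻¹ ∏_{i < j} (z_i - z_j) / (1 - z_i z_j)`
by induction on the number of variables. By induction on the number of letters,
`∑_μ (∑_λ s_{λ/μ}(x)) a_μ(z)` is the same product in `z` times
`∏ (1 - x_i)⁻¹ ∏_{i < j} (1 - x_i x_j)⁻¹ ∏ (1 - x_i z_j)⁻¹`: by branching, a letter `x_0` may be
moved to the variables at the cost of a factor `∏ (x_0 - z_i)`, which continuity allows to cancel.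

Evaluate the second identity at `z = t y` and the first at `z = y⁻¹`. Alternants are orthogonal on
the torus, `∫ a_μ(y) a_ν(y⁻¹) ∏ dy_i / y_i = q! (2πi)^q δ_{μν}`, so the integral of the product of
the two series is a multiple of `S_{n,k}(x; t)`, while the product of their closed forms is the
integrand up to the sign `(-1) ^ (q choose 2)`.
-/

/-- Partitions with at most `q` parts. -/
abbrev PartitionLE (q : ℕ) : Type := {μ : YoungDiagram // partLength μ ≤ q}

/-- The first `q` parts of a partition, as the exponent vector of an alternant in `q` variables;
missing parts are zero. -/
def parts {q : ℕ} (μ : YoungDiagram) (i : Fin q) : ℕ := μ.rowLen i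

theorem antitone_parts {q : ℕ} (μ : YoungDiagram) : Antitone (parts μ : Fin q → ℕ) :=
  fun _ _ h => μ.rowLen_anti _ _ h

theorem partLength_le_iff_rowLen_eq_zero {μ : YoungDiagram} {q : ℕ} :
    partLength μ ≤ q ↔ μ.rowLen q = 0 := by
  rw [partLength, ← not_lt, ← YoungDiagram.mem_iff_lt_colLen, YoungDiagram.mem_iff_lt_rowLen,
    not_lt, Nat.le_zero]

theorem rowLen_eq_zero {μ : YoungDiagram} {q i : ℕ} (hμ : partLength μ ≤ q) (hi : q ≤ i) :
    μ.rowLen i = 0 :=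
  partLength_le_iff_rowLen_eq_zero.1 (hμ.trans hi)

theorem le_iff_rowLen_le {μ κ : YoungDiagram} : μ ≤ κ ↔ ∀ i, μ.rowLen i ≤ κ.rowLen i := by
  simp only [SetLike.le_def, Prod.forall, YoungDiagram.mem_iff_lt_rowLen]
  exact forall_congr' fun i => ⟨le_of_forall_lt, fun h _ hj => hj.trans_le h⟩

theorem rowLen_bot (i : ℕ) : (⊥ : YoungDiagram).rowLen i = 0 :=
  Nat.le_zero.1 <| not_lt.1 fun h =>
    YoungDiagram.notMem_bot _ (YoungDiagram.mem_iff_lt_rowLen.2 h)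

theorem partLength_bot : partLength ⊥ = 0 :=
  Nat.le_zero.1 <| partLength_le_iff_rowLen_eq_zero.2 (rowLen_bot 0)

theorem parts_bot (q : ℕ) : (parts ⊥ : Fin q → ℕ) = 0 :=
  funext fun i => rowLen_bot i

theorem card_eq_zero_iff {μ : YoungDiagram} : μ.card = 0 ↔ μ = ⊥ :=
  Finset.card_eq_zero.trans (YoungDiagram.ext_iff (y := ⊥)).symm

theorem card_eq_sum_parts {μ : YoungDiagram} {q : ℕ} (hμ : partLength μ ≤ q) :
    μ.card = ∑ i : Fin q, parts μ i := by
  have hmaps : ∀ c ∈ μ.cells, c.1 ∈ Finset.range q := fun c hc => by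
    refine Finset.mem_range.2 (not_le.1 fun hq => ?_)
    have hlt := YoungDiagram.mem_iff_lt_rowLen.1 (YoungDiagram.mem_cells c |>.1 hc)
    exact absurd hlt (by simp [rowLen_eq_zero hμ hq])
  rw [YoungDiagram.card, Finset.card_eq_sum_card_fiberwise hmaps, Finset.sum_range]
  exact Finset.sum_congr rfl fun i _ => (μ.rowLen_eq_card).symm

theorem parts_injective (q : ℕ) :
    Function.Injective fun μ : PartitionLE q => (parts μ.1 : Fin q → ℕ) := by
  have hle : ∀ μ κ : PartitionLE q, (parts μ.1 : Fin q → ℕ) = parts κ.1 → μ.1 ≤ κ.1 :=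
    fun μ κ h => le_iff_rowLen_le.2 fun i => by
      rcases lt_or_ge i q with hi | hi
      · exact (congrFun h ⟨i, hi⟩).le
      · simp [rowLen_eq_zero μ.2 hi]
  exact fun μ κ h => Subtype.ext (le_antisymm (hle μ κ h) (hle κ μ h.symm))

instance (q : ℕ) : Countable (PartitionLE q) :=
  (parts_injective q).countable

instance : Unique (PartitionLE 0) :=
  haveI : Subsingleton (PartitionLE 0) := (parts_injective 0).subsingleton
  uniqueOfSubsingleton ⟨⊥, partLength_bot.le⟩

theorem exists_parts_eq {q : ℕ} {s : Fin q → ℕ} (hs : Antitone s) :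
    ∃ μ : PartitionLE q, parts μ.1 = s := by
  have hsorted : (List.ofFn s).SortedGE := List.sortedGE_ofFn_iff.2 hs
  have hlength : (List.ofFn s).length = q := List.length_ofFn
  have hpartLength : partLength (YoungDiagram.ofRowLens _ hsorted) ≤ q := by
    refine not_lt.1 fun hq => ?_
    obtain ⟨hq, -⟩ := YoungDiagram.mem_ofRowLens.1 (YoungDiagram.mem_iff_lt_colLen.2 hq)
    exact absurd hq hlength.not_gt
  refine ⟨⟨_, hpartLength⟩, funext fun i => ?_⟩
  exact (YoungDiagram.rowLen_ofRowLens (hw := hsorted) (i.cast hlength.symm)).trans (by simp)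

/-- As the ranges lie above one another, every choice of parts is a partition. -/
theorem hasSum_indicator_parts_iff {α : Type*} [AddCommMonoid α] [TopologicalSpace α] {q : ℕ}
    {S : Fin q → Set ℕ} (hS : ∀ i j, i < j → ∀ a ∈ S i, ∀ b ∈ S j, b ≤ a)
    {f : (Fin q → ℕ) → α} {v : α} :
    HasSum (fun μ : PartitionLE q => (Set.univ.pi S).indicator f (parts μ.1)) v ↔
      HasSum ((Set.univ.pi S).indicator f) v := by
  have hanti : ∀ s ∈ Set.univ.pi S, Antitone s := fun s hs i j hij => by
    rcases hij.eq_or_lt with rfl | hij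
    · exact le_rfl
    · exact hS i j hij _ (hs i trivial) _ (hs j trivial)
  rw [← (parts_injective q).hasSum_iff (f := (Set.univ.pi S).indicator f) fun s hs =>
    Set.indicator_of_notMem (fun hmem => hs (exists_parts_eq (hanti s hmem))) f]
  rfl

/-- `κ / μ` is a horizontal strip: it has at most one cell in each column. -/
def IsHorizontalStrip (κ μ : YoungDiagram) : Prop :=
  ∀ i, κ.rowLen (i + 1) ≤ μ.rowLen i ∧ μ.rowLen i ≤ κ.rowLen i

/-- The values that part `i` may take when a horizontal strip is added to `μ`. -/
def addStripRange (μ : YoungDiagram) (i : ℕ) : Set ℕ :=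
  {b | μ.rowLen i ≤ b ∧ ∀ j, j + 1 = i → b ≤ μ.rowLen j}

/-- The values that part `i` may take when a horizontal strip is removed from `κ`. -/
def removeStripRange (κ : YoungDiagram) (i : ℕ) : Set ℕ :=
  Set.Icc (κ.rowLen (i + 1)) (κ.rowLen i)

theorem le_of_mem_addStripRange {μ : YoungDiagram} {i j : ℕ} (h : i < j) :
    ∀ a ∈ addStripRange μ i, ∀ b ∈ addStripRange μ j, b ≤ a := by
  obtain ⟨j, rfl⟩ := Nat.exists_eq_add_of_lt h
  have hle : μ.rowLen (i + j) ≤ μ.rowLen i := μ.rowLen_anti _ _ (i.le_add_right j)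
  exact fun a ha b hb => (hb.2 (i + j) rfl).trans (hle.trans ha.1)

theorem le_of_mem_removeStripRange {κ : YoungDiagram} {i j : ℕ} (h : i < j) :
    ∀ a ∈ removeStripRange κ i, ∀ b ∈ removeStripRange κ j, b ≤ a :=
  fun _ ha _ hb => hb.2.trans ((κ.rowLen_anti _ _ h).trans ha.1)

namespace IsHorizontalStrip

theorem le {κ μ : YoungDiagram} (h : IsHorizontalStrip κ μ) : μ ≤ κ :=
  le_iff_rowLen_le.2 fun i => (h i).2

theorem card_le {κ μ : YoungDiagram} (h : IsHorizontalStrip κ μ) : μ.card ≤ κ.card :=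
  Finset.card_le_card (YoungDiagram.cells_subset_iff.2 h.le)

theorem partLength_le {κ μ : YoungDiagram} (h : IsHorizontalStrip κ μ) :
    partLength κ ≤ partLength μ + 1 := by
  rw [partLength_le_iff_rowLen_eq_zero, ← Nat.le_zero]
  exact (h _).1.trans (rowLen_eq_zero le_rfl le_rfl).le

end IsHorizontalStrip

theorem isHorizontalStrip_iff_mem_addStripRange {κ μ : YoungDiagram} {q : ℕ}
    (hκ : partLength κ ≤ q) (hμ : partLength μ ≤ q) :
    IsHorizontalStrip κ μ ↔ parts κ ∈ Set.univ.pi fun i : Fin q => addStripRange μ i := by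
  refine ⟨fun h i _ => ⟨(h i).2, fun j hj => (congrArg κ.rowLen hj).ge.trans (h j).1⟩,
    fun h i => ⟨?_, ?_⟩⟩
  · rcases lt_or_ge (i + 1) q with hi | hi
    · exact (h ⟨i + 1, hi⟩ trivial).2 i rfl
    · simp [rowLen_eq_zero hκ hi]
  · rcases lt_or_ge i q with hi | hi
    · exact (h ⟨i, hi⟩ trivial).1
    · simp [rowLen_eq_zero hμ hi]

theorem isHorizontalStrip_iff_mem_removeStripRange {κ μ : YoungDiagram} {q : ℕ}
    (hκ : partLength κ ≤ q + 1) (hμ : partLength μ ≤ q) :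
    IsHorizontalStrip κ μ ↔ parts μ ∈ Set.univ.pi fun i : Fin q => removeStripRange κ i := by
  refine ⟨fun h i _ => h i, fun h i => ?_⟩
  rcases lt_or_ge i q with hi | hi
  · exact h ⟨i, hi⟩ trivial
  · simp [rowLen_eq_zero hμ hi, rowLen_eq_zero hκ (Nat.succ_le_succ hi)]

section StripWeight

variable {R : Type*} [CommSemiring R]

open Classical in
/-- The skew Schur function `s_{κ/μ}(x)` in one variable. -/
noncomputable def stripWeight (x : R) (κ μ : YoungDiagram) : R :=
  if IsHorizontalStrip κ μ then x ^ (κ.card - μ.card) else 0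

theorem stripWeight_of_isHorizontalStrip {x : R} {κ μ : YoungDiagram} (h : IsHorizontalStrip κ μ) :
    stripWeight x κ μ = x ^ (κ.card - μ.card) :=
  if_pos h

theorem stripWeight_of_not_isHorizontalStrip {x : R} {κ μ : YoungDiagram}
    (h : ¬ IsHorizontalStrip κ μ) : stripWeight x κ μ = 0 :=
  if_neg h

theorem isHorizontalStrip_of_stripWeight_ne_zero {x : R} {κ μ : YoungDiagram}
    (h : stripWeight x κ μ ≠ 0) : IsHorizontalStrip κ μ :=
  not_imp_comm.1 stripWeight_of_not_isHorizontalStrip h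

theorem pow_card_sub_card (x : R) {κ μ : YoungDiagram} {q : ℕ} (hκ : partLength κ ≤ q)
    (hμ : partLength μ ≤ q) (h : μ ≤ κ) :
    x ^ (κ.card - μ.card) = ∏ i : Fin q, x ^ (parts κ i - parts μ i) := by
  have hle : ∀ i ∈ (Finset.univ : Finset (Fin q)), parts μ i ≤ parts κ i :=
    fun i _ => le_iff_rowLen_le.1 h i
  rw [card_eq_sum_parts hκ, card_eq_sum_parts hμ, Finset.prod_pow_eq_pow_sum,
    Finset.sum_tsub_distrib _ hle]

theorem stripWeight_eq_indicator_add (x : R) {κ μ : YoungDiagram} {q : ℕ}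
    (hκ : partLength κ ≤ q) (hμ : partLength μ ≤ q) :
    stripWeight x κ μ = (Set.univ.pi fun i : Fin q => addStripRange μ i).indicator
      (fun s => ∏ i, x ^ (s i - parts μ i)) (parts κ) := by
  by_cases h : IsHorizontalStrip κ μ
  · rw [stripWeight_of_isHorizontalStrip h, pow_card_sub_card x hκ hμ h.le,
      Set.indicator_of_mem ((isHorizontalStrip_iff_mem_addStripRange hκ hμ).1 h)]
  · rw [stripWeight_of_not_isHorizontalStrip h, Set.indicator_of_notMem
      (mt (isHorizontalStrip_iff_mem_addStripRange hκ hμ).2 h)]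

theorem stripWeight_eq_indicator_remove (x : R) {κ μ : YoungDiagram} {q : ℕ}
    (hκ : partLength κ ≤ q + 1) (hμ : partLength μ ≤ q) :
    stripWeight x κ μ = (Set.univ.pi fun i : Fin q => removeStripRange κ i).indicator
      (fun s => x ^ κ.rowLen q * ∏ i, x ^ (parts κ (Fin.castSucc i) - s i)) (parts μ) := by
  by_cases h : IsHorizontalStrip κ μ
  · rw [stripWeight_of_isHorizontalStrip h, pow_card_sub_card x hκ (hμ.trans q.le_succ) h.le,
      Set.indicator_of_mem ((isHorizontalStrip_iff_mem_removeStripRange hκ hμ).1 h),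
      Fin.prod_univ_castSucc, mul_comm]
    simp [parts, rowLen_eq_zero hμ]
  · rw [stripWeight_of_not_isHorizontalStrip h, Set.indicator_of_notMem
      (mt (isHorizontalStrip_iff_mem_removeStripRange hκ hμ).2 h)]

end StripWeight

section ProductSums

variable {R : Type*} [NormedCommRing R] {q : ℕ}

theorem summable_norm_prod_pi {f : Fin q → ℕ → R} (hf : ∀ i, Summable fun b => ‖f i b‖) :
    Summable fun s : Fin q → ℕ => ‖∏ i, f i (s i)‖ := by
  induction q with
  | zero => exact (hasSum_fintype _).summable
  | succ q ih =>
    rw [← (Fin.consEquiv fun _ : Fin (q + 1) => ℕ).summable_iff]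
    simpa [Function.comp_def, Fin.prod_univ_succ] using (hf 0).mul_norm (ih fun i => hf i.succ)

theorem hasSum_prod_pi [CompleteSpace R] {f : Fin q → ℕ → R}
    (hf : ∀ i, Summable fun b => ‖f i b‖) :
    HasSum (fun s : Fin q → ℕ => ∏ i, f i (s i)) (∏ i, ∑' b, f i b) := by
  induction q with
  | zero => simp
  | succ q ih =>
    rw [← (Fin.consEquiv fun _ : Fin (q + 1) => ℕ).hasSum_iff, Fin.prod_univ_succ,
      ← (ih fun i => hf i.succ).tsum_eq, tsum_mul_tsum_of_summable_norm (hf 0)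
        (summable_norm_prod_pi fun i => hf i.succ)]
    simpa [Function.comp_def, Fin.prod_univ_succ] using (summable_mul_of_summable_norm (hf 0)
      (summable_norm_prod_pi fun i => hf i.succ)).hasSum

theorem summable_pow_sum {r : ℝ} (h0 : 0 ≤ r) (h1 : r < 1) :
    Summable fun s : Fin q → ℕ => r ^ ∑ i, s i := by
  have hgeom : Summable fun b => ‖r ^ b‖ := by
    simpa [abs_of_nonneg h0] using summable_geometric_of_lt_one h0 h1
  simpa [Finset.prod_pow_eq_pow_sum] using
    (summable_norm_prod_pi fun _ : Fin q => hgeom).of_norm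

theorem indicator_pi_prod (S : Fin q → Set ℕ) (c : Fin q → ℕ → R) (s : Fin q → ℕ) :
    (Set.univ.pi S).indicator (fun s => ∏ i, c i (s i)) s = ∏ i, (S i).indicator (c i) (s i) := by
  classical
  simp only [Set.indicator_apply, Finset.prod_ite_zero, Set.mem_univ_pi, Finset.mem_univ,
    forall_const]

theorem hasSum_indicator_prod_parts [CompleteSpace R] {S : Fin q → Set ℕ}
    (hS : ∀ i j, i < j → ∀ a ∈ S i, ∀ b ∈ S j, b ≤ a) {c : Fin q → ℕ → R}
    (hc : ∀ i, Summable fun b => ‖(S i).indicator (c i) b‖) :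
    HasSum (fun μ : PartitionLE q =>
        (Set.univ.pi S).indicator (fun s => ∏ i, c i (s i)) (parts μ.1))
      (∏ i, ∑' b, (S i).indicator (c i) b) := by
  rw [hasSum_indicator_parts_iff hS, funext (indicator_pi_prod S c)]
  exact hasSum_prod_pi hc

end ProductSums

section Alternant

variable {R : Type*} {q : ℕ}

/-- The alternant `det (z_i ^ (s_j + q - 1 - j))` (with `j` counted from `0`), that is, the Schur
polynomial with row lengths `s` times the Vandermonde determinant. -/
def alternant [CommRing R] (s : Fin q → ℕ) (z : Fin q → R) : R :=
  Matrix.det (Matrix.of fun j i => z i ^ (s j + (Fin.rev j : ℕ)))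

theorem alternant_eq_sum [CommRing R] (s : Fin q → ℕ) (z : Fin q → R) :
    alternant s z = ∑ σ : Equiv.Perm (Fin q), ((Equiv.Perm.sign σ : ℤ) : R) *
      ∏ j, z (σ j) ^ (s j + (Fin.rev j : ℕ)) := by
  rw [alternant, ← Matrix.det_transpose, Matrix.det_apply']
  rfl

theorem continuous_alternant [CommRing R] [TopologicalSpace R] [IsTopologicalRing R]
    (s : Fin q → ℕ) : Continuous (alternant s : (Fin q → R) → R) := by
  simp only [funext (alternant_eq_sum s)]
  fun_prop

theorem hasSum_indicator_prod_mul_alternant [NormedCommRing R] [CompleteSpace R]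
    {S : Fin q → Set ℕ} (hS : ∀ i j, i < j → ∀ a ∈ S i, ∀ b ∈ S j, b ≤ a) {c : Fin q → ℕ → R}
    {z : Fin q → R}
    (hc : ∀ j i,
      Summable fun b => ‖(S j).indicator (fun b => c j b * z i ^ (b + (Fin.rev j : ℕ))) b‖) :
    HasSum (fun μ : PartitionLE q =>
        (Set.univ.pi S).indicator (fun s => ∏ j, c j (s j)) (parts μ.1) * alternant (parts μ.1) z)
      (Matrix.det (Matrix.of fun j i =>
        ∑' b, (S j).indicator (fun b => c j b * z i ^ (b + (Fin.rev j : ℕ))) b)) := by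
  rw [← Matrix.det_transpose, Matrix.det_apply']
  simp only [alternant_eq_sum, Finset.mul_sum, Matrix.transpose_apply, Matrix.of_apply]
  refine hasSum_sum fun σ _ => ?_
  refine ((hasSum_indicator_prod_parts hS fun j => hc j (σ j)).mul_left
    ((Equiv.Perm.sign σ : ℤ) : R)).congr_fun fun μ => ?_
  simp only [Finset.prod_mul_distrib, Set.indicator_mul_left, mul_left_comm]

end Alternant

theorem sub_mul_sum_Icc_pow {R : Type*} [CommRing R] (x z : R) {a b : ℕ} (h : a ≤ b) (c : ℕ) :
    (x - z) * ∑ s ∈ Finset.Icc a b, x ^ (b - s) * z ^ (s + c) =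
      x ^ (b - a + 1) * z ^ (a + c) - z ^ (b + c + 1) := by
  induction b, h using Nat.le_induction with
  | base => simp only [Finset.Icc_self, Finset.sum_singleton, Nat.sub_self]; ring
  | succ b hb ih =>
    have hsum : ∑ s ∈ Finset.Icc a b, x ^ (b + 1 - s) * z ^ (s + c) =
        x * ∑ s ∈ Finset.Icc a b, x ^ (b - s) * z ^ (s + c) := by
      rw [Finset.mul_sum]
      refine Finset.sum_congr rfl fun s hs => ?_
      rw [Nat.sub_add_comm (Finset.mem_Icc.1 hs).2]
      ring
    rw [← Finset.insert_Icc_right_eq_Icc_add_one (by omega), Finset.sum_insert (by simp), hsum,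
      mul_add, mul_left_comm (x - z) x, ih, Nat.sub_add_comm hb, Nat.sub_self]
    ring

theorem one_sub_mul_sum_Icc_pow {R : Type*} [CommRing R] (x z : R) {a b : ℕ} (h : a ≤ b) (c : ℕ) :
    (1 - x * z) * ∑ s ∈ Finset.Icc a b, x ^ (s - a) * z ^ (s + c) =
      z ^ (a + c) - x ^ (b - a + 1) * z ^ (b + c + 1) := by
  induction b, h using Nat.le_induction with
  | base => simp only [Finset.Icc_self, Finset.sum_singleton, Nat.sub_self]; ring
  | succ b hb ih =>
    rw [← Finset.insert_Icc_right_eq_Icc_add_one (by omega), Finset.sum_insert (by simp),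
      mul_add, ih, Nat.sub_add_comm hb]
    ring

theorem sum_Icc_pow_reflect {R : Type*} [Semiring R] (x : R) (a b : ℕ) :
    ∑ s ∈ Finset.Icc a b, x ^ (s - a) = ∑ s ∈ Finset.Icc a b, x ^ (b - s) := by
  refine Finset.sum_nbij' (a + b - ·) (a + b - ·) ?_ ?_ ?_ ?_ ?_ <;> intro s hs <;>
    simp only [Finset.mem_Icc] at hs ⊢
  · omega
  · omega
  · omega
  · omega
  · congr 1; omega

theorem tsum_indicator_Icc {M : Type*} [AddCommMonoid M] [TopologicalSpace M] (a b : ℕ)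
    (f : ℕ → M) :
    ∑' s, (Set.Icc a b).indicator f s = ∑ s ∈ Finset.Icc a b, f s := by
  rw [← tsum_subtype, ← Finset.coe_Icc, Finset.tsum_subtype']

theorem one_sub_ne_zero_of_norm_lt_one {𝕜 : Type*} [NormedField 𝕜] {x : 𝕜} (hx : ‖x‖ < 1) :
    1 - x ≠ 0 :=
  sub_ne_zero.2 fun h => by simp [← h] at hx

theorem summable_norm_indicator_pow_sub_mul_pow {𝕜 : Type*} [NormedField 𝕜] {x z : 𝕜}
    (h : ‖x * z‖ < 1) (S : Set ℕ) (a c : ℕ) :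
    Summable fun b => ‖S.indicator (fun b => x ^ (b - a) * z ^ (b + c)) b‖ := by
  suffices Summable fun b => ‖x ^ (b - a) * z ^ (b + c)‖ by
    simpa only [norm_indicator_eq_indicator_norm] using this.indicator S
  rw [← summable_nat_add_iff a]
  have hgeom := (summable_geometric_of_lt_one (norm_nonneg _) h).mul_right ‖z ^ (a + c)‖
  refine hgeom.congr fun b => ?_
  rw [← norm_pow, ← norm_mul, Nat.add_sub_cancel, add_assoc, pow_add z b, mul_pow, mul_assoc]

theorem one_sub_mul_tsum_Ici_pow {𝕜 : Type*} [NormedField 𝕜] [CompleteSpace 𝕜] {x z : 𝕜}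
    (h : ‖x * z‖ < 1) (a c : ℕ) :
    (1 - x * z) * ∑' b, (Set.Ici a).indicator (fun b => x ^ (b - a) * z ^ (b + c)) b =
      z ^ (a + c) := by
  have hsum := (summable_norm_indicator_pow_sub_mul_pow h (Set.Ici a) a c).of_norm
  have hhead : ∑ b ∈ Finset.range a,
      (Set.Ici a).indicator (fun b => x ^ (b - a) * z ^ (b + c)) b = 0 :=
    Finset.sum_eq_zero fun b hb => Set.indicator_of_notMem (by simpa using hb) _
  have htail : ∀ b, (Set.Ici a).indicator (fun b => x ^ (b - a) * z ^ (b + c)) (b + a) =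
      (x * z) ^ b * z ^ (a + c) := fun b => by
    rw [Set.indicator_of_mem (Set.mem_Ici.2 (a.le_add_left b)), Nat.add_sub_cancel, add_assoc,
      pow_add z, mul_pow, mul_assoc]
  rw [← hsum.sum_add_tsum_nat_add a, hhead, zero_add, tsum_congr htail, tsum_mul_right,
    tsum_geometric_of_norm_lt_one h, mul_inv_cancel_left₀ (one_sub_ne_zero_of_norm_lt_one h)]

theorem summable_norm_indicator_Icc {E : Type*} [SeminormedAddGroup E] (a b : ℕ) (f : ℕ → E) :
    Summable fun s => ‖(Set.Icc a b).indicator f s‖ :=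
  summable_of_hasFiniteSupport ((Set.finite_Icc a b).subset fun s hs => by
    contrapose! hs
    simp [hs])

section Pieri

variable {𝕜 : Type*} [NormedField 𝕜] [CompleteSpace 𝕜]

theorem addStripRange_zero (μ : YoungDiagram) : addStripRange μ 0 = Set.Ici (μ.rowLen 0) := by
  ext b
  simp [addStripRange]

theorem addStripRange_succ (μ : YoungDiagram) (i : ℕ) :
    addStripRange μ (i + 1) = Set.Icc (μ.rowLen (i + 1)) (μ.rowLen i) := by
  ext b
  simp [addStripRange]

theorem hasSum_stripWeight_add_mul_alternant {q : ℕ} {x : 𝕜} {z : Fin q → 𝕜}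
    (hxz : ∀ i, ‖x * z i‖ < 1) {μ : YoungDiagram} (hμ : partLength μ ≤ q) :
    HasSum (fun lam : PartitionLE q => stripWeight x lam.1 μ * alternant (parts lam.1) z)
      ((∏ i, (1 - x * z i)⁻¹) * alternant (parts μ) z) := by
  let M : Matrix (Fin q) (Fin q) 𝕜 := Matrix.of fun j i => ∑' b, (addStripRange μ j).indicator
    (fun b => x ^ (b - parts μ j) * z i ^ (b + (Fin.rev j : ℕ))) b
  have hsum : HasSum (fun lam : PartitionLE q => stripWeight x lam.1 μ * alternant (parts lam.1) z)
      M.det := by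
    refine (hasSum_indicator_prod_mul_alternant (fun i j => le_of_mem_addStripRange)
      fun j i => summable_norm_indicator_pow_sub_mul_pow (hxz i) _ _ _).congr_fun fun lam => ?_
    rw [stripWeight_eq_indicator_add x lam.2 hμ]
  have hdet : alternant (parts μ) z = Matrix.det (Matrix.of fun j i => (1 - x * z i) * M j i) := by
    cases q with
    | zero => simp [alternant]
    | succ q =>
      refine Matrix.det_eq_of_forall_row_eq_smul_add_pred
        (fun i => x ^ (μ.rowLen i - μ.rowLen (i + 1) + 1)) (fun j => ?_) fun i j => ?_
      · simp only [Matrix.of_apply, M, parts, Fin.val_zero, addStripRange_zero,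
          one_sub_mul_tsum_Ici_pow (hxz j)]
      · have hle : μ.rowLen (i + 1) ≤ μ.rowLen i := μ.rowLen_anti _ _ i.val.le_succ
        simp only [Matrix.of_apply, M, parts, Fin.val_succ, Fin.val_castSucc, addStripRange_succ,
          tsum_indicator_Icc, one_sub_mul_sum_Icc_pow x (z j) hle, Fin.rev_castSucc, Fin.rev_succ]
        ring
  have hne : ∀ i, 1 - x * z i ≠ 0 := fun i => one_sub_ne_zero_of_norm_lt_one (hxz i)
  rwa [hdet, Matrix.det_mul_row, ← mul_assoc, ← Finset.prod_mul_distrib,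
    Finset.prod_eq_one fun i _ => inv_mul_cancel₀ (hne i), one_mul]

theorem tsum_stripWeight_add {q : ℕ} {x : 𝕜} (hx : ‖x‖ < 1) {lam : YoungDiagram}
    (hlam : partLength lam ≤ q) :
    ∑' κ : PartitionLE (q + 1), stripWeight x κ.1 lam = (1 - x)⁻¹ *
      ∏ i : Fin q, ∑ b ∈ Finset.Icc (lam.rowLen (i + 1)) (lam.rowLen i),
        x ^ (b - lam.rowLen (i + 1)) := by
  have hone : ‖x * 1‖ < 1 := by rwa [mul_one]
  have hsum := hasSum_indicator_prod_parts (q := q + 1) (S := fun i => addStripRange lam i)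
    (c := fun i b => x ^ (b - parts lam i)) (fun i j => le_of_mem_addStripRange)
    fun i => by simpa using summable_norm_indicator_pow_sub_mul_pow hone _ (parts lam i) 0
  have hfirst : ∑' b, (addStripRange lam 0).indicator (fun b => x ^ (b - lam.rowLen 0)) b =
      (1 - x)⁻¹ := by
    rw [addStripRange_zero, ← inv_mul_cancel_left₀ (one_sub_ne_zero_of_norm_lt_one hx)
      (∑' b, (Set.Ici (lam.rowLen 0)).indicator (fun b => x ^ (b - lam.rowLen 0)) b)]
    simpa using congrArg ((1 - x)⁻¹ * ·) (one_sub_mul_tsum_Ici_pow hone (lam.rowLen 0) 0)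
  simp only [Fin.prod_univ_succ, Fin.val_zero, Fin.val_succ, parts, addStripRange_succ,
    tsum_indicator_Icc, hfirst] at hsum
  rw [← hsum.tsum_eq]
  refine tsum_congr fun κ => ?_
  simp only [stripWeight_eq_indicator_add x κ.2 (hlam.trans q.le_succ), Fin.prod_univ_succ, parts,
    Fin.val_zero, Fin.val_succ]

theorem tsum_stripWeight_remove (x : 𝕜) {q : ℕ} {lam : YoungDiagram} (hlam : partLength lam ≤ q) :
    ∑' μ : PartitionLE q, stripWeight x lam μ.1 =
      ∏ i : Fin q, ∑ b ∈ Finset.Icc (lam.rowLen (i + 1)) (lam.rowLen i),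
        x ^ (lam.rowLen i - b) := by
  have hsum := hasSum_indicator_prod_parts (q := q) (S := fun i => removeStripRange lam i)
    (c := fun i b => x ^ (lam.rowLen i - b)) (fun i j => le_of_mem_removeStripRange)
    fun i => summable_norm_indicator_Icc _ _ _
  simp only [removeStripRange, tsum_indicator_Icc] at hsum
  rw [← hsum.tsum_eq]
  refine tsum_congr fun μ => ?_
  simp [stripWeight_eq_indicator_remove x (hlam.trans q.le_succ) μ.2, rowLen_eq_zero hlam le_rfl,
    parts, removeStripRange]

theorem tsum_stripWeight_add_eq_tsum_stripWeight_remove {q : ℕ} {x : 𝕜} (hx : ‖x‖ < 1)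
    {lam : YoungDiagram} (hlam : partLength lam ≤ q) :
    ∑' κ : PartitionLE (q + 1), stripWeight x κ.1 lam =
      (1 - x)⁻¹ * ∑' μ : PartitionLE q, stripWeight x lam μ.1 := by
  simp only [tsum_stripWeight_add hx hlam, tsum_stripWeight_remove x hlam, sum_Icc_pow_reflect]

end Pieri

section Branching

theorem det_eq_of_forall_row_eq_smul_add_next {R : Type*} [CommRing R] {n : ℕ}
    {A B : Matrix (Fin (n + 1)) (Fin (n + 1)) R} (c : Fin n → R)
    (A_last : ∀ j, A (Fin.last n) j = B (Fin.last n) j)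
    (A_castSucc : ∀ (i : Fin n) (j), A i.castSucc j = B i.castSucc j + c i * A i.succ j) :
    A.det = B.det := by
  rw [← Matrix.det_submatrix_equiv_self Fin.revPerm A,
    ← Matrix.det_submatrix_equiv_self Fin.revPerm B]
  refine Matrix.det_eq_of_forall_row_eq_smul_add_pred (fun i => c i.rev) (fun j => ?_) fun i j => ?_
  · simp [A_last]
  · simp [A_castSucc, Fin.rev_succ, Fin.rev_castSucc]

theorem det_of_forall_castSucc_zero_eq_zero {R : Type*} [CommRing R] {n : ℕ}
    {A : Matrix (Fin (n + 1)) (Fin (n + 1)) R} (hA : ∀ j : Fin n, A j.castSucc 0 = 0) :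
    A.det = (-1) ^ n * A (Fin.last n) 0 * (A.submatrix Fin.castSucc Fin.succ).det := by
  rw [Matrix.det_succ_column_zero, Fin.sum_univ_castSucc, Finset.sum_eq_zero fun j _ => by
    simp [hA j], zero_add, Fin.val_last, Fin.succAbove_last]

theorem alternant_cons {R : Type*} [CommRing R] {q : ℕ} {s : Fin (q + 1) → ℕ} (hs : Antitone s)
    (x : R) (z : Fin q → R) :
    alternant s (Fin.cons x z) = (∏ i, (x - z i)) * (x ^ s (Fin.last q) *
      Matrix.det (Matrix.of fun j i : Fin q => ∑ b ∈ Finset.Icc (s j.succ) (s j.castSucc),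
        x ^ (s j.castSucc - b) * z i ^ (b + (Fin.rev j : ℕ)))) := by
  have hle : ∀ j : Fin q, s j.succ ≤ s j.castSucc := fun j => hs Fin.castSucc_lt_succ.le
  let w : Fin (q + 1) → R := Fin.cons x z
  let B : Matrix (Fin (q + 1)) (Fin (q + 1)) R := Matrix.of fun j i =>
    Fin.lastCases (w i ^ s (Fin.last q))
      (fun j : Fin q => w i ^ (s j.castSucc + (Fin.rev j : ℕ) + 1) -
        x ^ (s j.castSucc - s j.succ + 1) * w i ^ (s j.succ + (Fin.rev j : ℕ))) j
  have hdet : alternant s w = B.det := by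
    refine det_eq_of_forall_row_eq_smul_add_next
      (fun j => x ^ (s j.castSucc - s j.succ + 1)) (fun i => ?_) fun j i => ?_
    · simp [B]
    · simp only [B, Matrix.of_apply, Fin.lastCases_castSucc, Fin.rev_castSucc, Fin.rev_succ,
        Fin.val_succ, Fin.val_castSucc]
      ring
  have hcol : ∀ j : Fin q, B j.castSucc 0 = 0 := fun j => by
    have hexp : s j.castSucc + (Fin.rev j : ℕ) + 1 =
        s j.castSucc - s j.succ + 1 + (s j.succ + (Fin.rev j : ℕ)) := by have := hle j; omega
    simp only [B, w, Matrix.of_apply, Fin.lastCases_castSucc, Fin.cons_zero, ← pow_add, hexp,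
      sub_self]
  have hminor : B.submatrix Fin.castSucc Fin.succ = Matrix.of fun j i =>
      (-(x - z i)) * (Matrix.of fun j i => ∑ b ∈ Finset.Icc (s j.succ) (s j.castSucc),
        x ^ (s j.castSucc - b) * z i ^ (b + (Fin.rev j : ℕ))) j i := by
    ext j i
    simp only [Matrix.submatrix_apply, Matrix.of_apply, neg_mul,
      sub_mul_sum_Icc_pow x (z i) (hle j), B, w, Fin.lastCases_castSucc, Fin.cons_succ]
    ring
  have hcorner : B (Fin.last q) 0 = x ^ s (Fin.last q) := by simp [B, w]
  rw [show (Fin.cons x z : Fin (q + 1) → R) = w from rfl, hdet,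
    det_of_forall_castSucc_zero_eq_zero hcol, hminor, Matrix.det_mul_row, Finset.prod_neg, hcorner,
    Finset.card_univ, Fintype.card_fin]
  have hsign : (-1 : R) ^ q * (-1) ^ q = 1 := by rw [← mul_pow]; simp
  linear_combination (x ^ s (Fin.last q) * (∏ i, (x - z i)) * Matrix.det (Matrix.of fun j i =>
    ∑ b ∈ Finset.Icc (s j.succ) (s j.castSucc),
      x ^ (s j.castSucc - b) * z i ^ (b + (Fin.rev j : ℕ)))) * hsign

theorem alternant_cons_eq_prod_sub_mul_tsum {R : Type*} [NormedCommRing R] [CompleteSpace R] {q : ℕ}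
    {κ : YoungDiagram} (hκ : partLength κ ≤ q + 1) (x : R) (z : Fin q → R) :
    alternant (parts κ) (Fin.cons x z) = (∏ i, (x - z i)) *
      ∑' lam : PartitionLE q, stripWeight x κ lam.1 * alternant (parts lam.1) z := by
  have hsum := (hasSum_indicator_prod_mul_alternant (S := fun i : Fin q => removeStripRange κ i)
    (c := fun i b => x ^ (κ.rowLen i - b)) (z := z) (fun i j => le_of_mem_removeStripRange)
    fun j i => summable_norm_indicator_Icc _ _ _).mul_left (x ^ κ.rowLen q)
  simp only [removeStripRange, tsum_indicator_Icc] at hsum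
  rw [alternant_cons (antitone_parts κ)]
  congr 1
  refine hsum.tsum_eq.symm.trans (tsum_congr fun lam => ?_)
  rw [stripWeight_eq_indicator_remove x hκ lam.2, Set.indicator_const_mul, mul_assoc]
  rfl

end Branching

section Summability

theorem summable_pow_card (q : ℕ) {r : ℝ} (h0 : 0 ≤ r) (h1 : r < 1) :
    Summable fun μ : PartitionLE q => r ^ μ.1.card :=
  ((summable_pow_sum h0 h1).comp_injective (parts_injective q)).congr fun μ => by
    rw [card_eq_sum_parts μ.2, Function.comp_apply]

theorem summable_prod_of_norm_le_pow_card {E : Type*} [NormedAddCommGroup E] [CompleteSpace E]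
    {p q : ℕ} {f : PartitionLE p × PartitionLE q → E} {C r : ℝ} (h0 : 0 ≤ r) (h1 : r < 1)
    (hf : ∀ a, ‖f a‖ ≤ C * r ^ a.1.1.card) (hcard : ∀ a, f a ≠ 0 → a.2.1.card ≤ a.1.1.card) :
    Summable f := by
  have hs1 : √r < 1 := by rwa [Real.sqrt_lt' one_pos, one_pow]
  have hsum := ((summable_pow_card p (Real.sqrt_nonneg r) hs1).mul_of_nonneg
    (summable_pow_card q (Real.sqrt_nonneg r) hs1) (fun _ => by positivity)
    fun _ => by positivity).mul_left |C|
  refine .of_norm_bounded hsum fun a => ?_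
  by_cases ha : f a = 0
  · rw [ha, norm_zero]
    positivity
  · calc ‖f a‖ ≤ C * r ^ a.1.1.card := hf a
      _ ≤ |C| * (√r ^ a.1.1.card * √r ^ a.1.1.card) := by
          rw [← mul_pow, Real.mul_self_sqrt h0]
          exact mul_le_mul_of_nonneg_right (le_abs_self C) (by positivity)
      _ ≤ |C| * (√r ^ a.1.1.card * √r ^ a.2.1.card) := by
          have := pow_le_pow_of_le_one (Real.sqrt_nonneg r) hs1.le (hcard a ha)
          gcongr

variable {𝕜 : Type*} [NormedField 𝕜]

theorem norm_alternant_le {q : ℕ} (s : Fin q → ℕ) {z : Fin q → 𝕜} {r : ℝ} (hz : ∀ i, ‖z i‖ ≤ r) :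
    ‖alternant s z‖ ≤ q.factorial * r ^ ∑ i, (s i + (Fin.rev i : ℕ)) := by
  have hterm : ∀ σ : Equiv.Perm (Fin q), ‖((Equiv.Perm.sign σ : ℤ) : 𝕜) *
      ∏ j, z (σ j) ^ (s j + (Fin.rev j : ℕ))‖ ≤ r ^ ∑ i, (s i + (Fin.rev i : ℕ)) := fun σ => by
    have hsign : ‖((Equiv.Perm.sign σ : ℤ) : 𝕜)‖ = 1 := by
      rcases Int.units_eq_one_or (Equiv.Perm.sign σ) with h | h <;> simp [h]
    rw [norm_mul, hsign, one_mul, norm_prod, ← Finset.prod_pow_eq_pow_sum]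
    refine Finset.prod_le_prod (fun _ _ => norm_nonneg _) fun j _ => ?_
    rw [norm_pow]
    exact pow_le_pow_left₀ (norm_nonneg _) (hz _) _
  rw [alternant_eq_sum]
  exact (norm_sum_le_of_le _ fun σ _ => hterm σ).trans (by simp [Fintype.card_perm])

theorem norm_alternant_le_of_le_one {q : ℕ} (s : Fin q → ℕ) {z : Fin q → 𝕜} {r : ℝ}
    (hz : ∀ i, ‖z i‖ ≤ r) (hr : r ≤ 1) : ‖alternant s z‖ ≤ q.factorial * r ^ ∑ i, s i := by
  refine (norm_alternant_le s hz).trans (mul_le_mul_of_nonneg_left ?_ (by positivity))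
  rcases isEmpty_or_nonempty (Fin q) with _ | ⟨⟨i⟩⟩
  · simp only [Finset.univ_eq_empty, Finset.sum_empty, le_refl]
  · exact pow_le_pow_of_le_one ((norm_nonneg _).trans (hz i)) hr
      (Finset.sum_le_sum fun _ _ => Nat.le_add_right _ _)

theorem norm_stripWeight_le {x : 𝕜} {r : ℝ} (hx : ‖x‖ ≤ r) (κ μ : YoungDiagram) :
    ‖stripWeight x κ μ‖ ≤ r ^ (κ.card - μ.card) := by
  by_cases h : IsHorizontalStrip κ μ
  · rw [stripWeight_of_isHorizontalStrip h, norm_pow]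
    exact pow_le_pow_left₀ (norm_nonneg _) hx _
  · rw [stripWeight_of_not_isHorizontalStrip h, norm_zero]
    exact pow_nonneg ((norm_nonneg _).trans hx) _

end Summability

section Littlewood

variable {𝕜 : Type*} [NormedField 𝕜]

theorem norm_stripWeight_mul_alternant_le {q : ℕ} {x : 𝕜} {z : Fin q → 𝕜} {r : ℝ} (hx : ‖x‖ ≤ r)
    (hz : ∀ i, ‖z i‖ ≤ r) (hr : r ≤ 1) (κ : YoungDiagram) {μ : YoungDiagram}
    (hμ : partLength μ ≤ q) :
    ‖stripWeight x κ μ * alternant (parts μ) z‖ ≤ q.factorial * r ^ κ.card := by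
  have h0 : 0 ≤ r := (norm_nonneg x).trans hx
  by_cases h : IsHorizontalStrip κ μ
  · calc ‖stripWeight x κ μ * alternant (parts μ) z‖
        ≤ r ^ (κ.card - μ.card) * (q.factorial * r ^ μ.card) := by
          rw [norm_mul]
          refine mul_le_mul (norm_stripWeight_le hx κ μ) ?_ (norm_nonneg _) (by positivity)
          rw [card_eq_sum_parts hμ]
          exact norm_alternant_le_of_le_one _ hz hr
      _ = q.factorial * r ^ κ.card := by
          rw [mul_left_comm, ← pow_add, Nat.sub_add_cancel h.card_le]
  · rw [stripWeight_of_not_isHorizontalStrip h, zero_mul, norm_zero]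
    positivity

/-- The right-hand side `∏ i, (1 - z_i)⁻¹ * ∏ i < j, (z_i - z_j) / (1 - z_i z_j)` of Littlewood's
identity for the sum of all alternants. -/
def littlewoodProd {K : Type*} [Field K] {q : ℕ} (z : Fin q → K) : K :=
  (∏ i, (1 - z i)⁻¹) * ∏ i, ∏ j ∈ Finset.Ioi i, (z i - z j) / (1 - z i * z j)

theorem littlewoodProd_cons {K : Type*} [Field K] {q : ℕ} (x : K) (z : Fin q → K) :
    littlewoodProd (Fin.cons x z : Fin (q + 1) → K) =
      (∏ i, (x - z i)) * ((1 - x)⁻¹ * ((∏ i, (1 - x * z i)⁻¹) * littlewoodProd z)) := by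
  simp only [littlewoodProd, Fin.prod_univ_succ, Fin.cons_zero, Fin.cons_succ,
    Fin.prod_Ioi_zero, Fin.prod_Ioi_succ, div_eq_mul_inv, Finset.prod_mul_distrib]
  ring

variable [CompleteSpace 𝕜]

theorem summable_stripWeight_mul_alternant_remove {p q : ℕ} {g : PartitionLE p → 𝕜} {C : ℝ}
    (hg : ∀ κ, ‖g κ‖ ≤ C) {x : 𝕜} (hx : ‖x‖ < 1) {z : Fin q → 𝕜} (hz : ∀ i, ‖z i‖ < 1) :
    Summable fun a : PartitionLE p × PartitionLE q =>
      g a.1 * (stripWeight x a.1.1 a.2.1 * alternant (parts a.2.1) z) := by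
  have hr : max ‖x‖ ‖z‖ < 1 := max_lt hx ((pi_norm_lt_iff one_pos).2 hz)
  refine summable_prod_of_norm_le_pow_card (C := C * q.factorial)
    ((norm_nonneg x).trans (le_max_left _ ‖z‖)) hr (fun a => ?_) fun a ha => ?_
  · rw [norm_mul, mul_assoc]
    exact mul_le_mul (hg _) (norm_stripWeight_mul_alternant_le (le_max_left _ _)
      (fun i => (norm_le_pi_norm z i).trans (le_max_right _ _)) hr.le _ a.2.2) (norm_nonneg _)
      ((norm_nonneg _).trans (hg a.1))
  · exact (isHorizontalStrip_of_stripWeight_ne_zero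
      (left_ne_zero_of_mul (right_ne_zero_of_mul ha))).card_le

theorem summable_stripWeight_mul_alternant_add {q : ℕ} {x : 𝕜} (hx : ‖x‖ < 1) {z : Fin q → 𝕜}
    (hz : ∀ i, ‖z i‖ < 1) :
    Summable fun a : PartitionLE q × PartitionLE q =>
      stripWeight x a.1.1 a.2.1 * alternant (parts a.1.1) z := by
  have hr : ‖z‖ < 1 := (pi_norm_lt_iff one_pos).2 hz
  refine summable_prod_of_norm_le_pow_card (C := q.factorial) (norm_nonneg z) hr (fun a => ?_)
    fun a ha => ?_
  · rw [norm_mul, card_eq_sum_parts a.1.2]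
    have hstrip := (norm_stripWeight_le hx.le a.1.1 a.2.1).trans_eq (one_pow _)
    exact (mul_le_of_le_one_left (norm_nonneg _) hstrip).trans
      (norm_alternant_le_of_le_one _ (norm_le_pi_norm z) hr.le)
  · exact (isHorizontalStrip_of_stripWeight_ne_zero (left_ne_zero_of_mul ha)).card_le

theorem tsum_mul_alternant_cons {q : ℕ} {g : PartitionLE (q + 1) → 𝕜} {C : ℝ}
    (hg : ∀ κ, ‖g κ‖ ≤ C) {x : 𝕜} (hx : ‖x‖ < 1) {z : Fin q → 𝕜} (hz : ∀ i, ‖z i‖ < 1) :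
    ∑' κ : PartitionLE (q + 1), g κ * alternant (parts κ.1) (Fin.cons x z) =
      (∏ i, (x - z i)) * ∑' μ : PartitionLE q,
        (∑' κ : PartitionLE (q + 1), stripWeight x κ.1 μ.1 * g κ) * alternant (parts μ.1) z := by
  calc ∑' κ : PartitionLE (q + 1), g κ * alternant (parts κ.1) (Fin.cons x z)
      = (∏ i, (x - z i)) * ∑' (κ : PartitionLE (q + 1)) (μ : PartitionLE q),
          g κ * (stripWeight x κ.1 μ.1 * alternant (parts μ.1) z) := by
        rw [← tsum_mul_left]
        refine tsum_congr fun κ => ?_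
        rw [alternant_cons_eq_prod_sub_mul_tsum κ.2, mul_left_comm, tsum_mul_left]
    _ = (∏ i, (x - z i)) * ∑' μ : PartitionLE q,
        (∑' κ : PartitionLE (q + 1), stripWeight x κ.1 μ.1 * g κ) * alternant (parts μ.1) z := by
        have hcomm := Summable.tsum_comm
          (f := fun (κ : PartitionLE (q + 1)) (μ : PartitionLE q) =>
            g κ * (stripWeight x κ.1 μ.1 * alternant (parts μ.1) z))
          (summable_stripWeight_mul_alternant_remove hg hx hz)
        refine congrArg _ (hcomm.symm.trans ?_)
        refine tsum_congr fun μ => ?_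
        rw [← tsum_mul_right]
        exact tsum_congr fun κ => by ring

theorem tsum_alternant {q : ℕ} {z : Fin q → 𝕜} (hz : ∀ i, ‖z i‖ < 1) :
    ∑' μ : PartitionLE q, alternant (parts μ.1) z = littlewoodProd z := by
  induction q with
  | zero => simp [alternant, littlewoodProd]
  | succ q ih =>
    cases z using Fin.consCases with
    | _ x z =>
    have hx : ‖x‖ < 1 := hz 0
    replace hz : ∀ i, ‖z i‖ < 1 := fun i => hz i.succ
    have hxz : ∀ i, ‖x * z i‖ < 1 := fun i => by
      rw [norm_mul]
      exact mul_lt_one_of_nonneg_of_lt_one_left (norm_nonneg _) hx (hz i).le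
    have hcons := tsum_mul_alternant_cons (q := q) (g := fun _ => 1) (fun _ => norm_one.le) hx hz
    simp only [one_mul, mul_one] at hcons
    rw [hcons, littlewoodProd_cons, ← ih hz]
    congr 1
    calc ∑' μ : PartitionLE q, (∑' κ : PartitionLE (q + 1), stripWeight x κ.1 μ.1) *
          alternant (parts μ.1) z
        = (1 - x)⁻¹ * ∑' (lam : PartitionLE q) (μ : PartitionLE q),
            stripWeight x lam.1 μ.1 * alternant (parts lam.1) z := by
          rw [← tsum_mul_left]
          refine tsum_congr fun lam => ?_
          rw [tsum_stripWeight_add_eq_tsum_stripWeight_remove hx lam.2, mul_assoc, tsum_mul_right]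
      _ = (1 - x)⁻¹ * ∑' (μ : PartitionLE q) (lam : PartitionLE q),
            stripWeight x lam.1 μ.1 * alternant (parts lam.1) z := by
          rw [Summable.tsum_comm (f := fun lam μ : PartitionLE q =>
            stripWeight x lam.1 μ.1 * alternant (parts lam.1) z)
            (summable_stripWeight_mul_alternant_add hx hz)]
      _ = (1 - x)⁻¹ * ((∏ i, (1 - x * z i)⁻¹) * ∑' μ : PartitionLE q, alternant (parts μ.1) z) := by
          rw [← tsum_mul_left (a := ∏ i, (1 - x * z i)⁻¹)]
          congr 1
          exact tsum_congr fun μ => (hasSum_stripWeight_add_mul_alternant hxz μ.2).tsum_eq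

end Littlewood

section SkewTableaux

variable {lam κ μ : YoungDiagram} {l : ℕ}

theorem mem_cells_sdiff {c : ℕ × ℕ} : c ∈ lam.cells \ μ.cells ↔ c ∈ lam ∧ c ∉ μ := by
  simp only [Finset.mem_sdiff, YoungDiagram.mem_cells]

/-- A cell of `lam / κ`, seen as a cell of `lam / μ`. -/
def outerCell (h : μ ≤ κ) (c : SkewCell lam κ) : SkewCell lam μ :=
  ⟨c.1, mem_cells_sdiff.2 ((mem_cells_sdiff.1 c.2).imp_right (mt (@h c.1)))⟩

open Classical in
/-- The tableau of shape `lam / μ` obtained from a tableau of shape `lam / κ` by raising every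
entry and filling the cells of `κ / μ` with the smallest letter. -/
noncomputable def extendByZero (T : SkewCell lam κ → Fin l) (c : SkewCell lam μ) : Fin (l + 1) :=
  if h : c.1 ∈ κ then 0 else (T ⟨c.1, mem_cells_sdiff.2 ⟨(mem_cells_sdiff.1 c.2).1, h⟩⟩).succ

theorem extendByZero_of_mem (T : SkewCell lam κ → Fin l) {c : SkewCell lam μ} (h : c.1 ∈ κ) :
    extendByZero T c = 0 :=
  dif_pos h

theorem extendByZero_of_notMem (T : SkewCell lam κ → Fin l) {c : SkewCell lam μ} (h : c.1 ∉ κ) :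
    extendByZero T c = (T ⟨c.1, mem_cells_sdiff.2 ⟨(mem_cells_sdiff.1 c.2).1, h⟩⟩).succ :=
  dif_neg h

theorem extendByZero_outerCell (h : μ ≤ κ) (T : SkewCell lam κ → Fin l) (c : SkewCell lam κ) :
    extendByZero T (outerCell h c) = (T c).succ :=
  extendByZero_of_notMem T (mem_cells_sdiff.1 c.2).2

theorem extendByZero_eq_zero_iff {T : SkewCell lam κ → Fin l} {c : SkewCell lam μ} :
    extendByZero T c = 0 ↔ c.1 ∈ κ := by
  refine ⟨fun h => ?_, extendByZero_of_mem T⟩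
  by_contra hc
  exact Fin.succ_ne_zero _ ((extendByZero_of_notMem T hc).symm.trans h)

theorem extendByZero_injective (h : μ ≤ κ) :
    Function.Injective (extendByZero (lam := lam) (κ := κ) (μ := μ) (l := l)) :=
  fun T T' hT => funext fun c => Fin.succ_injective _ <| by
    rw [← extendByZero_outerCell h T, ← extendByZero_outerCell h T', hT]

theorem le_of_extendByZero_eq {κ' : YoungDiagram} (hκ' : μ ≤ κ') (hκ : κ ≤ lam)
    {T : SkewCell lam κ → Fin l} {T' : SkewCell lam κ' → Fin l}
    (h : (extendByZero T : SkewCell lam μ → _) = extendByZero T') : κ ≤ κ' := by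
  intro c hc
  by_cases hcμ : c ∈ μ
  · exact hκ' hcμ
  · let c' : SkewCell lam μ := ⟨c, mem_cells_sdiff.2 ⟨hκ hc, hcμ⟩⟩
    exact extendByZero_eq_zero_iff.1 ((congrFun h c').symm.trans (extendByZero_of_mem T hc))

theorem prod_extendByZero {R : Type*} [CommMonoid R] (hμ : μ ≤ κ) (hκ : κ ≤ lam)
    (x : Fin (l + 1) → R) (T : SkewCell lam κ → Fin l) :
    ∏ c : SkewCell lam μ, x (extendByZero T c) =
      x 0 ^ (κ.card - μ.card) * ∏ c, Fin.tail x (T c) := by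
  classical
  rw [← Fintype.prod_subtype_mul_prod_subtype fun c : SkewCell lam μ => c.1 ∈ κ]
  congr 1
  · let e : {c : SkewCell lam μ // c.1 ∈ κ} ≃ ↥(κ.cells \ μ.cells) :=
      (Equiv.subtypeSubtypeEquivSubtypeInter _ (· ∈ κ)).trans <| Equiv.subtypeEquivRight fun c => by
        simp only [mem_cells_sdiff]
        exact ⟨fun h => ⟨h.2, h.1.2⟩, fun h => ⟨⟨hκ h.1, h.2⟩, h.1⟩⟩
    rw [Fintype.prod_congr _ (fun _ => x 0) fun c => by rw [extendByZero_of_mem T c.2],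
      Finset.prod_const, Finset.card_univ, Fintype.card_congr e, Fintype.card_coe,
      Finset.card_sdiff_of_subset (YoungDiagram.cells_subset_iff.2 hμ)]
  · let e : {c : SkewCell lam μ // c.1 ∉ κ} ≃ SkewCell lam κ :=
      (Equiv.subtypeSubtypeEquivSubtypeInter _ (· ∉ κ)).trans <| Equiv.subtypeEquivRight fun c => by
        simp only [mem_cells_sdiff]
        exact ⟨fun h => ⟨h.1.1, h.2⟩, fun h => ⟨⟨h.1, mt (@hμ c) h.2⟩, h.2⟩⟩
    exact Fintype.prod_equiv e _ _ fun c => by rw [extendByZero_of_notMem T c.2]; rfl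

theorem isHorizontalStrip_iff_mem :
    IsHorizontalStrip κ μ ↔ μ ≤ κ ∧ ∀ i j, (i + 1, j) ∈ κ → (i, j) ∈ μ := by
  simp only [IsHorizontalStrip, forall_and, ← le_iff_rowLen_le, YoungDiagram.mem_iff_lt_rowLen]
  rw [and_comm]
  exact and_congr_right' (forall_congr' fun i => ⟨fun h _ hj => hj.trans_le h, le_of_forall_lt⟩)

theorem isSkewSSYT_extendByZero (hstrip : IsHorizontalStrip κ μ) {T : SkewCell lam κ → Fin l}
    (hT : IsSkewSSYT T) : IsSkewSSYT (extendByZero T : SkewCell lam μ → Fin (l + 1)) := by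
  refine ⟨hstrip.le.trans hT.1, fun c d hrow hcol => ?_, fun c d hcol hrow => ?_⟩
  · by_cases hc : c.1 ∈ κ
    · rw [extendByZero_of_mem T hc]
      exact Fin.zero_le _
    · have hd : d.1 ∉ κ := fun h => hc (κ.up_left_mem hrow.le hcol.le h)
      rw [extendByZero_of_notMem T hc, extendByZero_of_notMem T hd, Fin.succ_le_succ_iff]
      exact hT.2.1 _ _ hrow hcol
  · have hd : d.1 ∉ κ := fun h => (mem_cells_sdiff.1 c.2).2 <|
      (isHorizontalStrip_iff_mem.1 hstrip).2 _ _ (κ.up_left_mem hrow hcol.le h)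
    rw [extendByZero_of_notMem T hd]
    by_cases hc : c.1 ∈ κ
    · rw [extendByZero_of_mem T hc]
      exact Fin.succ_pos _
    · rw [extendByZero_of_notMem T hc, Fin.succ_lt_succ_iff]
      exact hT.2.2 _ _ hcol hrow

namespace IsSkewSSYT

variable {T : SkewCell lam μ → Fin l}

theorem monotone (hT : IsSkewSSYT T) {c d : SkewCell lam μ} (hrow : c.1.1 ≤ d.1.1)
    (hcol : c.1.2 ≤ d.1.2) : T c ≤ T d := by
  let e : SkewCell lam μ := ⟨(c.1.1, d.1.2), mem_cells_sdiff.2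
    ⟨lam.up_left_mem hrow le_rfl (mem_cells_sdiff.1 d.2).1,
      fun h => (mem_cells_sdiff.1 c.2).2 (μ.up_left_mem le_rfl hcol h)⟩⟩
  have hce : T c ≤ T e := by
    rcases hcol.eq_or_lt with h | h
    · exact (congrArg T (Subtype.ext (Prod.ext rfl h) : c = e)).le
    · exact hT.2.1 c e rfl h
  have hed : T e ≤ T d := by
    rcases hrow.eq_or_lt with h | h
    · exact (congrArg T (Subtype.ext (Prod.ext h rfl) : e = d)).le
    · exact (hT.2.2 e d rfl h).le
  exact hce.trans hed

variable {T : SkewCell lam μ → Fin (l + 1)}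

open Classical in
/-- The diagram formed by `μ` and the cells of `lam / μ` that carry the smallest letter. -/
noncomputable def zeroRegion (hT : IsSkewSSYT T) : YoungDiagram where
  cells := {c ∈ lam.cells | ∀ h : c ∈ lam.cells \ μ.cells, T ⟨c, h⟩ = 0}
  isLowerSet c d hdc hc := by
    simp only [Finset.coe_filter, Set.mem_ofPred_eq, YoungDiagram.mem_cells] at hc ⊢
    refine ⟨lam.up_left_mem hdc.1 hdc.2 hc.1, fun hd => ?_⟩
    have hcμ : c ∉ μ := fun h => (mem_cells_sdiff.1 hd).2 (μ.up_left_mem hdc.1 hdc.2 h)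
    have hc0 := hc.2 (mem_cells_sdiff.2 ⟨hc.1, hcμ⟩)
    exact Fin.le_zero_iff.1 (hc0 ▸ hT.monotone hdc.1 hdc.2)

theorem mem_zeroRegion (hT : IsSkewSSYT T) {c : ℕ × ℕ} :
    c ∈ hT.zeroRegion ↔ c ∈ lam ∧ ∀ h : c ∈ lam.cells \ μ.cells, T ⟨c, h⟩ = 0 := by
  rw [← YoungDiagram.mem_cells, zeroRegion, Finset.mem_filter, YoungDiagram.mem_cells]

theorem zeroRegion_le (hT : IsSkewSSYT T) : hT.zeroRegion ≤ lam :=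
  fun _ hc => (hT.mem_zeroRegion.1 hc).1

theorem isHorizontalStrip_zeroRegion (hT : IsSkewSSYT T) :
    IsHorizontalStrip hT.zeroRegion μ := by
  refine isHorizontalStrip_iff_mem.2 ⟨fun c hc => ?_, fun i j h => ?_⟩
  · exact hT.mem_zeroRegion.2 ⟨hT.1 hc, fun h => absurd hc (mem_cells_sdiff.1 h).2⟩
  · by_contra hij
    obtain ⟨hlam, h0⟩ := hT.mem_zeroRegion.1 h
    have hlow : (i + 1, j) ∈ lam.cells \ μ.cells :=
      mem_cells_sdiff.2 ⟨hlam, mt (μ.up_left_mem i.le_succ le_rfl) hij⟩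
    have hup : (i, j) ∈ lam.cells \ μ.cells :=
      mem_cells_sdiff.2 ⟨lam.up_left_mem i.le_succ le_rfl hlam, hij⟩
    exact Fin.not_lt_zero _ (h0 hlow ▸ hT.2.2 ⟨_, hup⟩ ⟨_, hlow⟩ rfl i.lt_succ_self)

theorem exists_extendByZero_eq (hT : IsSkewSSYT T) :
    ∃ T' : SkewCell lam hT.zeroRegion → Fin l, IsSkewSSYT T' ∧ extendByZero T' = T := by
  have hle : μ ≤ hT.zeroRegion := hT.isHorizontalStrip_zeroRegion.le
  have hne : ∀ c : SkewCell lam hT.zeroRegion, T (outerCell hle c) ≠ 0 := fun c h =>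
    (mem_cells_sdiff.1 c.2).2 (hT.mem_zeroRegion.2 ⟨(mem_cells_sdiff.1 c.2).1, fun _ => h⟩)
  refine ⟨fun c => (T (outerCell hle c)).pred (hne c), ⟨hT.zeroRegion_le, ?_, ?_⟩, ?_⟩
  · exact fun c d hrow hcol => Fin.pred_le_pred_iff.2 (hT.2.1 _ _ hrow hcol)
  · exact fun c d hcol hrow => Fin.pred_lt_pred_iff.2 (hT.2.2 _ _ hcol hrow)
  · funext c
    by_cases hc : c.1 ∈ hT.zeroRegion
    · rw [extendByZero_of_mem _ hc, (hT.mem_zeroRegion.1 hc).2 c.2]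
    · rw [extendByZero_of_notMem _ hc, Fin.succ_pred]
      rfl

end IsSkewSSYT

end SkewTableaux

section SkewSchur

variable {R : Type*} [CommSemiring R] {lam μ : YoungDiagram} {l : ℕ}

open Classical in
/-- The skew Schur function evaluated in an arbitrary commutative semiring. Over `ℂ` it is
`skewSchur`, by definition; over `ℝ≥0∞` it bounds the norm of the complex one. -/
noncomputable def skewSchurEval (lam μ : YoungDiagram) {l : ℕ} (x : Fin l → R) : R :=
  ∑ T : SkewCell lam μ → Fin l with IsSkewSSYT T, ∏ c, x (T c)

theorem skewSchurEval_of_not_le (x : Fin l → R) (h : ¬ μ ≤ lam) : skewSchurEval lam μ x = 0 := by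
  classical
  exact Finset.sum_eq_zero fun _ hT => absurd (Finset.mem_filter.1 hT).2.1 h

theorem skewSchurEval_self (x : Fin l → R) : skewSchurEval μ μ x = 1 := by
  have : IsEmpty (SkewCell μ μ) := ⟨fun c => (mem_cells_sdiff.1 c.2).2 (mem_cells_sdiff.1 c.2).1⟩
  have huniv : ∀ T : SkewCell μ μ → Fin l, IsSkewSSYT T := fun T =>
    ⟨le_rfl, fun c => isEmptyElim c, fun c => isEmptyElim c⟩
  simp [skewSchurEval, huniv]

theorem skewSchurEval_fin_zero_of_ne (x : Fin 0 → R) (h : lam ≠ μ) :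
    skewSchurEval lam μ x = 0 := by
  classical
  refine Finset.sum_eq_zero fun T hT => ?_
  obtain ⟨c, hc, hcμ⟩ := SetLike.not_le_iff_exists.1
    (mt (Finset.mem_filter.1 hT).2.1.antisymm h.symm)
  exact (T ⟨c, mem_cells_sdiff.2 ⟨hc, hcμ⟩⟩).elim0

theorem finite_Iic (lam : YoungDiagram) : (Set.Iic lam).Finite :=
  .of_finite_image (f := YoungDiagram.cells)
    (lam.cells.powerset.finite_toSet.subset <| by
      rintro _ ⟨κ, hκ, rfl⟩
      exact Finset.mem_coe.2 (Finset.mem_powerset.2 (YoungDiagram.cells_subset_iff.2 hκ)))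
    fun _ _ _ _ h => YoungDiagram.ext h

/-- A tableau splits into the strip of its smallest letter and a tableau in the other letters. -/
theorem skewSchurEval_succ (lam μ : YoungDiagram) (x : Fin (l + 1) → R) :
    skewSchurEval lam μ x = ∑ κ ∈ (finite_Iic lam).toFinset,
      stripWeight (x 0) κ μ * skewSchurEval lam κ (Fin.tail x) := by
  classical
  have hstrips : ∑ κ ∈ (finite_Iic lam).toFinset,
        stripWeight (x 0) κ μ * skewSchurEval lam κ (Fin.tail x) =
      ∑ p ∈ ({κ ∈ (finite_Iic lam).toFinset | IsHorizontalStrip κ μ}).sigma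
          fun κ => ({T | IsSkewSSYT T} : Finset (SkewCell lam κ → Fin l)),
        x 0 ^ (p.1.card - μ.card) * ∏ c, Fin.tail x (p.2 c) := by
    simp only [Finset.sum_sigma, ← Finset.mul_sum]
    rw [Finset.sum_filter]
    simp only [stripWeight, skewSchurEval, ite_mul, zero_mul]
  rw [hstrips]
  symm
  refine Finset.sum_bij (fun p _ => extendByZero p.2) (fun p hp => ?_) (fun p hp p' hp' h => ?_)
    (fun T hT => ?_) fun p hp => ?_
  all_goals simp only [Finset.mem_sigma, Finset.mem_filter, Set.Finite.mem_toFinset, Set.mem_Iic,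
    Finset.mem_univ, true_and] at *
  · exact isSkewSSYT_extendByZero hp.1.2 hp.2
  · obtain ⟨κ, T⟩ := p
    obtain ⟨κ', T'⟩ := p'
    obtain rfl : κ = κ' := le_antisymm (le_of_extendByZero_eq hp'.1.2.le hp.1.1 h)
      (le_of_extendByZero_eq hp.1.2.le hp'.1.1 h.symm)
    exact congrArg _ (extendByZero_injective hp.1.2.le h)
  · obtain ⟨T', hT', hext⟩ := hT.exists_extendByZero_eq
    exact ⟨⟨_, T'⟩, ⟨⟨hT.zeroRegion_le, hT.isHorizontalStrip_zeroRegion⟩, hT'⟩, hext⟩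
  · exact (prod_extendByZero hp.1.2.le hp.1.1 x p.2).symm

theorem skewSchurEval_eq_zero_of_lt_partLength (x : Fin l → R)
    (h : partLength μ + l < partLength lam) : skewSchurEval lam μ x = 0 := by
  induction l generalizing μ with
  | zero => exact skewSchurEval_fin_zero_of_ne x fun hlam => (hlam ▸ h).false
  | succ l ih =>
    rw [skewSchurEval_succ]
    refine Finset.sum_eq_zero fun κ _ => ?_
    by_cases hκ : IsHorizontalStrip κ μ
    · rw [ih (Fin.tail x) (by have := hκ.partLength_le; omega), mul_zero]
    · rw [stripWeight_of_not_isHorizontalStrip hκ, zero_mul]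

theorem hasSum_stripWeight_mul_skewSchurEval [TopologicalSpace R] {q : ℕ} (lam : YoungDiagram)
    (hμ : partLength μ ≤ q) (x : Fin (l + 1) → R) :
    HasSum (fun κ : PartitionLE (q + 1) =>
      stripWeight (x 0) κ.1 μ * skewSchurEval lam κ.1 (Fin.tail x)) (skewSchurEval lam μ x) := by
  have hsupport : Function.support
      (fun κ => stripWeight (x 0) κ μ * skewSchurEval lam κ (Fin.tail x)) ⊆
      {κ | partLength κ ≤ q + 1} := fun κ hκ =>
    (isHorizontalStrip_of_stripWeight_ne_zero (left_ne_zero_of_mul hκ)).partLength_le.trans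
      (Nat.succ_le_succ hμ)
  refine (hasSum_subtype_iff_of_support_subset hsupport).2 ?_
  rw [skewSchurEval_succ]
  refine hasSum_sum_of_ne_finset_zero fun κ hκ => ?_
  rw [skewSchurEval_of_not_le _ (by simpa using hκ), mul_zero]

end SkewSchur

section OuterSkewSum

open scoped ENNReal

theorem tsum_stripWeight_le {x : ℝ≥0∞} {q : ℕ} {μ : YoungDiagram} (hμ : partLength μ ≤ q) :
    ∑' κ : PartitionLE q, stripWeight x κ.1 μ ≤ ∑' s : Fin q → ℕ, x ^ ∑ i, s i := by
  let strips : Set (PartitionLE q) := {κ | IsHorizontalStrip κ.1 μ}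
  have hsupport : (Function.support fun κ : PartitionLE q => stripWeight x κ.1 μ) ⊆ strips :=
    fun _ => isHorizontalStrip_of_stripWeight_ne_zero
  have hinj : Function.Injective fun (κ : strips) (i : Fin q) => parts κ.1.1 i - parts μ i := by
    refine fun κ κ' h => Subtype.ext (parts_injective q (funext fun i => ?_))
    have hκ : parts μ i ≤ parts κ.1.1 i := (κ.2 i).2
    have hκ' : parts μ i ≤ parts κ'.1.1 i := (κ'.2 i).2
    exact (tsub_left_inj hκ hκ').1 (congrFun h i)
  rw [← tsum_subtype_eq_of_support_subset hsupport]
  refine (ENNReal.tsum_comp_le_tsum_of_injective hinj _).trans' (tsum_congr fun κ => ?_).le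
  have hκ : IsHorizontalStrip κ.1.1 μ := κ.2
  rw [stripWeight_of_isHorizontalStrip hκ, pow_card_sub_card x κ.1.2 hμ hκ.le,
    Finset.prod_pow_eq_pow_sum]

theorem tsum_pow_sum_ne_top {x : ℝ≥0∞} (hx : x < 1) (q : ℕ) :
    ∑' s : Fin q → ℕ, x ^ ∑ i, s i ≠ ∞ := by
  lift x to NNReal using hx.ne_top
  simp only [← ENNReal.coe_pow, ENNReal.tsum_coe_ne_top_iff_summable, ← NNReal.summable_coe,
    NNReal.coe_pow]
  exact summable_pow_sum x.2 (by exact_mod_cast hx)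

/-- The sum over all partitions `lam` of the skew Schur functions `s_{lam/μ}(x)`. -/
noncomputable def outerSkewSum {R : Type*} [CommSemiring R] [TopologicalSpace R] {l : ℕ}
    (x : Fin l → R) (μ : YoungDiagram) : R :=
  ∑' lam, skewSchurEval lam μ x

theorem outerSkewSum_fin_zero {R : Type*} [CommSemiring R] [TopologicalSpace R] (x : Fin 0 → R)
    (μ : YoungDiagram) : outerSkewSum x μ = 1 := by
  rw [outerSkewSum, tsum_eq_single μ fun lam hlam => skewSchurEval_fin_zero_of_ne x hlam,
    skewSchurEval_self]

theorem outerSkewSum_succ_ennreal {l q : ℕ} (x : Fin (l + 1) → ℝ≥0∞) {μ : YoungDiagram}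
    (hμ : partLength μ ≤ q) : outerSkewSum x μ =
      ∑' κ : PartitionLE (q + 1), stripWeight (x 0) κ.1 μ * outerSkewSum (Fin.tail x) κ.1 := by
  simp only [outerSkewSum, ← (hasSum_stripWeight_mul_skewSchurEval _ hμ x).tsum_eq,
    ENNReal.tsum_comm (α := YoungDiagram), ENNReal.tsum_mul_left]

theorem exists_outerSkewSum_le {l : ℕ} {x : Fin l → ℝ≥0∞} (hx : ∀ i, x i < 1) (q : ℕ) :
    ∃ B ≠ ∞, ∀ μ : PartitionLE q, outerSkewSum x μ.1 ≤ B := by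
  induction l generalizing q with
  | zero => exact ⟨1, ENNReal.one_ne_top, fun μ => (outerSkewSum_fin_zero x μ.1).le⟩
  | succ l ih =>
    obtain ⟨B, hB, hle⟩ := ih (x := Fin.tail x) (fun i => hx i.succ) (q + 1)
    refine ⟨_, ENNReal.mul_ne_top (tsum_pow_sum_ne_top (hx 0) (q + 1)) hB, fun μ => ?_⟩
    calc outerSkewSum x μ.1
        = ∑' κ : PartitionLE (q + 1),
            stripWeight (x 0) κ.1 μ.1 * outerSkewSum (Fin.tail x) κ.1 :=
          outerSkewSum_succ_ennreal x μ.2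
      _ ≤ ∑' κ : PartitionLE (q + 1), stripWeight (x 0) κ.1 μ.1 * B :=
          ENNReal.tsum_le_tsum fun κ => mul_le_mul_right (hle κ) _
      _ ≤ (∑' s : Fin (q + 1) → ℕ, x 0 ^ ∑ i, s i) * B := by
          rw [ENNReal.tsum_mul_right]
          exact mul_le_mul_left (tsum_stripWeight_le (μ.2.trans q.le_succ)) B

variable {𝕜 : Type*} [NormedField 𝕜] {l : ℕ}

theorem enorm_stripWeight (x : 𝕜) (κ μ : YoungDiagram) :
    ‖stripWeight x κ μ‖ₑ = stripWeight ‖x‖ₑ κ μ := by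
  by_cases h : IsHorizontalStrip κ μ
  · simp only [stripWeight_of_isHorizontalStrip h, enorm_pow]
  · simp only [stripWeight_of_not_isHorizontalStrip h, enorm_zero]

theorem enorm_skewSchurEval_le (lam μ : YoungDiagram) (x : Fin l → 𝕜) :
    ‖skewSchurEval lam μ x‖ₑ ≤ skewSchurEval lam μ fun i => ‖x i‖ₑ :=
  (enorm_sum_le _ _).trans_eq <| Finset.sum_congr rfl fun T _ => by
    simp only [enorm_eq_nnnorm, nnnorm_prod, ENNReal.ofNNReal_finsetProd]

theorem tsum_enorm_skewSchurEval_le (μ : YoungDiagram) (x : Fin l → 𝕜) :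
    ∑' lam, ‖skewSchurEval lam μ x‖ₑ ≤ outerSkewSum (fun i => ‖x i‖ₑ) μ :=
  ENNReal.tsum_le_tsum fun lam => enorm_skewSchurEval_le lam μ x

theorem exists_tsum_enorm_skewSchurEval_le {x : Fin l → 𝕜} (hx : ∀ i, ‖x i‖ < 1) (q : ℕ) :
    ∃ B ≠ ∞, ∀ μ : PartitionLE q, ∑' lam, ‖skewSchurEval lam μ.1 x‖ₑ ≤ B := by
  obtain ⟨B, hB, hle⟩ := exists_outerSkewSum_le (x := fun i => ‖x i‖ₑ)
    (fun i => ofReal_norm (x i) ▸ ENNReal.ofReal_lt_one.2 (hx i)) q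
  exact ⟨B, hB, fun μ => (tsum_enorm_skewSchurEval_le μ.1 x).trans (hle μ)⟩

theorem exists_norm_outerSkewSum_le {x : Fin l → 𝕜} (hx : ∀ i, ‖x i‖ < 1) (q : ℕ) :
    ∃ C : ℝ, ∀ μ : PartitionLE q, ‖outerSkewSum x μ.1‖ ≤ C := by
  obtain ⟨B, hB, hle⟩ := exists_tsum_enorm_skewSchurEval_le hx q
  refine ⟨B.toReal, fun μ => ?_⟩
  rw [← toReal_enorm]
  exact ENNReal.toReal_mono hB (enorm_tsum_le_tsum_enorm.trans (hle μ))

theorem outerSkewSum_succ [CompleteSpace 𝕜] {q : ℕ} {x : Fin (l + 1) → 𝕜} (hx : ∀ i, ‖x i‖ < 1)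
    {μ : YoungDiagram} (hμ : partLength μ ≤ q) : outerSkewSum x μ =
      ∑' κ : PartitionLE (q + 1), stripWeight (x 0) κ.1 μ * outerSkewSum (Fin.tail x) κ.1 := by
  have hsum : Summable (Function.uncurry fun (κ : PartitionLE (q + 1)) lam =>
      stripWeight (x 0) κ.1 μ * skewSchurEval lam κ.1 (Fin.tail x)) := by
    obtain ⟨B, hB, hle⟩ := exists_outerSkewSum_le (x := fun i => ‖x i‖ₑ)
      (fun i => ofReal_norm (x i) ▸ ENNReal.ofReal_lt_one.2 (hx i)) q
    refine .of_enorm (ne_top_of_le_ne_top hB (le_trans ?_ (hle ⟨μ, hμ⟩)))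
    rw [ENNReal.tsum_prod', outerSkewSum_succ_ennreal _ hμ]
    simp only [Function.uncurry_apply_pair, enorm_mul, enorm_stripWeight, ENNReal.tsum_mul_left]
    exact ENNReal.tsum_le_tsum fun κ => mul_le_mul_right (tsum_enorm_skewSchurEval_le κ.1 _) _
  simp only [outerSkewSum, ← (hasSum_stripWeight_mul_skewSchurEval _ hμ x).tsum_eq,
    hsum.tsum_comm, tsum_mul_left]

end OuterSkewSum

section OuterSkewSumAlternant

variable {R : Type*} [CommRing R] {𝕜 : Type*} [NontriviallyNormedField 𝕜]

theorem prod_prod_Ioi_const {q : ℕ} (t : R) :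
    ∏ i : Fin q, ∏ _j ∈ Finset.Ioi i, t = t ^ ∑ i : Fin q, (Fin.rev i : ℕ) := by
  rw [← Finset.prod_pow_eq_pow_sum]
  refine Finset.prod_congr rfl fun i _ => ?_
  rw [Finset.prod_const, Fin.card_Ioi, Fin.val_rev, Nat.sub_sub, add_comm]

theorem alternant_zero {q : ℕ} (z : Fin q → R) :
    alternant 0 z = ∏ i, ∏ j ∈ Finset.Ioi i, (z i - z j) := by
  have hmatrix : Matrix.projVandermonde 1 z =
      Matrix.of fun i j : Fin q => z i ^ ((0 : Fin q → ℕ) j + (Fin.rev j : ℕ)) := by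
    ext i j
    simp [Matrix.projVandermonde_apply]
  rw [alternant, ← Matrix.det_transpose]
  exact (congrArg Matrix.det hmatrix.symm).trans (by simp [Matrix.det_projVandermonde])

theorem alternant_smul {q : ℕ} (s : Fin q → ℕ) (t : R) (z : Fin q → R) :
    alternant s (t • z) =
      t ^ (∑ i : Fin q, (Fin.rev i : ℕ)) * (t ^ (∑ i, s i) * alternant s z) := by
  simp only [alternant_eq_sum, Finset.mul_sum]
  refine Finset.sum_congr rfl fun σ _ => ?_
  simp only [Pi.smul_apply, smul_eq_mul, mul_pow, Finset.prod_mul_distrib,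
    Finset.prod_pow_eq_pow_sum, pow_add]
  ring

/-- The value `∏ i, (1 - x_i)⁻¹ * ∏ i < j, (1 - x_i x_j)⁻¹` of the sum of all Schur functions. -/
def schurProd {K : Type*} [Field K] {l : ℕ} (x : Fin l → K) : K :=
  (∏ i, (1 - x i)⁻¹) * ∏ i, ∏ j ∈ Finset.Ioi i, (1 - x i * x j)⁻¹

theorem schurProd_succ {K : Type*} [Field K] {l : ℕ} (x : Fin (l + 1) → K) :
    schurProd x =
      (1 - x 0)⁻¹ * (∏ i, (1 - Fin.tail x i * x 0)⁻¹) * schurProd (Fin.tail x) := by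
  simp only [schurProd, Fin.prod_univ_succ, Fin.prod_Ioi_zero, Fin.prod_Ioi_succ, Fin.tail,
    mul_comm (x 0)]
  ring

theorem eqOn_of_prod_sub_mul_eq {q : ℕ} (x : 𝕜) {U : Set (Fin q → 𝕜)} (hU : IsOpen U)
    {f g : (Fin q → 𝕜) → 𝕜} (hf : ContinuousOn f U) (hg : ContinuousOn g U)
    (h : ∀ z ∈ U, (∏ i, (x - z i)) * f z = (∏ i, (x - z i)) * g z) : Set.EqOn f g U := by
  have hdense : Dense (Set.univ.pi fun _ : Fin q => ({x}ᶜ : Set 𝕜)) :=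
    dense_pi _ fun _ _ => dense_compl_singleton x
  refine Set.EqOn.of_subset_closure (fun z hz => mul_left_cancel₀ ?_ (h z hz.1)) hf hg
    Set.inter_subset_left (hdense.open_subset_closure_inter hU)
  exact Finset.prod_ne_zero_iff.2 fun i _ => sub_ne_zero.2 (Ne.symm (hz.2 i trivial))

theorem continuousOn_prod_prod_one_sub_mul_inv {l q : ℕ} {x : Fin l → 𝕜} (hx : ∀ i, ‖x i‖ < 1)
    {r : ℝ} (hr : r < 1) :
    ContinuousOn (fun z : Fin q → 𝕜 => ∏ i, ∏ j, (1 - x i * z j)⁻¹) (Metric.ball 0 r) := by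
  refine continuousOn_finsetProd _ fun i _ => continuousOn_finsetProd _ fun j _ => ?_
  refine ContinuousOn.inv₀ (by fun_prop) fun z hz => one_sub_ne_zero_of_norm_lt_one ?_
  rw [norm_mul]
  exact mul_lt_one_of_nonneg_of_lt_one_left (norm_nonneg _) (hx i)
    ((norm_le_pi_norm z j).trans ((mem_ball_zero_iff.1 hz).trans hr).le)

variable [CompleteSpace 𝕜]

theorem continuousOn_tsum_mul_alternant {q : ℕ} {g : PartitionLE q → 𝕜} {C : ℝ}
    (hg : ∀ μ, ‖g μ‖ ≤ C) {r : ℝ} (hr : r < 1) :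
    ContinuousOn (fun z : Fin q → 𝕜 => ∑' μ, g μ * alternant (parts μ.1) z)
      (Metric.ball 0 r) := by
  rcases le_or_gt r 0 with h0 | h0
  · rw [Metric.ball_eq_empty.2 h0]
    exact continuousOn_empty _
  refine continuousOn_tsum (fun μ => ?_)
    ((summable_pow_card q h0.le hr).mul_left (C * q.factorial)) fun μ z hz => ?_
  · exact continuousOn_const.mul (continuous_alternant _).continuousOn
  · rw [norm_mul, mul_assoc, card_eq_sum_parts μ.2]
    exact mul_le_mul (hg μ) (norm_alternant_le_of_le_one _ (fun i => (norm_le_pi_norm z i).trans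
      (mem_ball_zero_iff.1 hz).le) hr.le) (norm_nonneg _) ((norm_nonneg _).trans (hg μ))

theorem continuousOn_littlewoodProd {q : ℕ} {r : ℝ} (hr : r < 1) :
    ContinuousOn (littlewoodProd : (Fin q → 𝕜) → 𝕜) (Metric.ball 0 r) := by
  refine (continuousOn_tsum_mul_alternant (g := fun _ => 1) (fun _ => norm_one.le) hr).congr
    fun z hz => ?_
  simp only [one_mul]
  exact (tsum_alternant fun i => (norm_le_pi_norm z i).trans_lt
    ((mem_ball_zero_iff.1 hz).trans hr)).symm

theorem tsum_outerSkewSum_mul_alternant_cons {l : ℕ} {x : Fin (l + 1) → 𝕜} (hx : ∀ i, ‖x i‖ < 1)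
    {q : ℕ} {z : Fin q → 𝕜} (hz : ∀ i, ‖z i‖ < 1) :
    ∑' κ : PartitionLE (q + 1),
        outerSkewSum (Fin.tail x) κ.1 * alternant (parts κ.1) (Fin.cons (x 0) z) =
      (∏ i, (x 0 - z i)) *
        ∑' μ : PartitionLE q, outerSkewSum x μ.1 * alternant (parts μ.1) z := by
  obtain ⟨C, hC⟩ := exists_norm_outerSkewSum_le (x := Fin.tail x) (fun i => hx i.succ) (q + 1)
  rw [tsum_mul_alternant_cons hC (hx 0) hz]
  exact congrArg _ (tsum_congr fun μ => by rw [outerSkewSum_succ hx μ.2])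

theorem tsum_outerSkewSum_mul_alternant {l : ℕ} {x : Fin l → 𝕜} (hx : ∀ i, ‖x i‖ < 1) {q : ℕ}
    {z : Fin q → 𝕜} (hz : ∀ i, ‖z i‖ < 1) :
    ∑' μ : PartitionLE q, outerSkewSum x μ.1 * alternant (parts μ.1) z =
      schurProd x * (∏ i, ∏ j, (1 - x i * z j)⁻¹) * littlewoodProd z := by
  induction l generalizing q with
  | zero => simp [outerSkewSum_fin_zero, tsum_alternant hz, schurProd]
  | succ l ih =>
    obtain ⟨r, hzr, hr⟩ := exists_between ((pi_norm_lt_iff one_pos).2 hz)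
    obtain ⟨C, hC⟩ := exists_norm_outerSkewSum_le hx q
    have hcontinuous := (continuousOn_const (c := schurProd x)).mul
      (continuousOn_prod_prod_one_sub_mul_inv hx hr) |>.mul
        (continuousOn_littlewoodProd (q := q) hr)
    refine eqOn_of_prod_sub_mul_eq (x 0) Metric.isOpen_ball
      (continuousOn_tsum_mul_alternant hC hr) hcontinuous (fun w hw => ?_)
      (mem_ball_zero_iff.2 hzr)
    have hw1 : ∀ i, ‖w i‖ < 1 := fun i =>
      (norm_le_pi_norm w i).trans_lt ((mem_ball_zero_iff.1 hw).trans hr)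
    have hcons : ∀ i, ‖(Fin.cons (x 0) w : Fin (q + 1) → 𝕜) i‖ < 1 := Fin.cases (hx 0) hw1
    rw [← tsum_outerSkewSum_mul_alternant_cons hx hw1, ih (x := Fin.tail x) (fun i => hx i.succ)
      hcons]
    simp only [Pi.mul_apply, schurProd_succ x, littlewoodProd_cons]
    simp only [Fin.prod_univ_succ, Fin.cons_zero, Fin.cons_succ, Finset.prod_mul_distrib, Fin.tail]
    ring

theorem outerSkewSum_bot {l : ℕ} {x : Fin l → 𝕜} (hx : ∀ i, ‖x i‖ < 1) :
    outerSkewSum x ⊥ = schurProd x := by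
  have h := tsum_outerSkewSum_mul_alternant hx (q := 0) (z := Fin.elim0) (fun i => i.elim0)
  rw [tsum_eq_single ⟨⊥, partLength_bot.le⟩ fun μ hμ => absurd (Subsingleton.elim _ _) hμ] at h
  simpa [alternant, littlewoodProd] using h

theorem tsum_outerSkewSum_mul_pow_card_mul_alternant {l : ℕ} {x : Fin l → 𝕜}
    (hx : ∀ i, ‖x i‖ < 1) {q : ℕ} {t : 𝕜} {y : Fin q → 𝕜} (hty : ∀ i, ‖t * y i‖ < 1) :
    ∑' μ : PartitionLE q, outerSkewSum x μ.1 * (t ^ μ.1.card * alternant (parts μ.1) y) =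
      schurProd x * (∏ i, ∏ j, (1 - x i * (t * y j))⁻¹) * ((∏ i, (1 - t * y i)⁻¹) *
        ∏ i, ∏ j ∈ Finset.Ioi i, (y i - y j) / (1 - t * y i * (t * y j))) := by
  rcases eq_or_ne t 0 with rfl | ht
  · rw [tsum_eq_single ⟨⊥, partLength_bot.le.trans q.zero_le⟩ fun μ hμ => ?_]
    · simp [outerSkewSum_bot hx, parts_bot, card_eq_zero_iff.2, alternant_zero]
    · rw [zero_pow (mt card_eq_zero_iff.1 fun h => hμ (Subtype.ext h)), zero_mul, mul_zero]
  · have hscale : t ^ (∑ i : Fin q, (Fin.rev i : ℕ)) ≠ 0 := pow_ne_zero _ ht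
    refine mul_left_cancel₀ hscale ?_
    have h := tsum_outerSkewSum_mul_alternant hx (z := t • y) hty
    rw [← tsum_mul_left]
    refine (tsum_congr fun μ => ?_).trans (h.trans ?_)
    · rw [alternant_smul, card_eq_sum_parts μ.2, mul_left_comm]
    · simp only [littlewoodProd, ← prod_prod_Ioi_const, Pi.smul_apply, smul_eq_mul, mul_div_assoc,
        ← mul_sub, Finset.prod_mul_distrib]
      ring

end OuterSkewSumAlternant

section TorusIntegral

variable {q : ℕ} {c : Fin q → ℂ} {R : Fin q → ℝ}

theorem continuous_torusMap (c : Fin q → ℂ) (R : Fin q → ℝ) : Continuous (torusMap c R) := by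
  unfold torusMap
  fun_prop

theorem norm_torusMap_zero_apply (R θ : Fin q → ℝ) (i : Fin q) : ‖torusMap 0 R θ i‖ = |R i| := by
  simp [torusMap, Complex.norm_exp_ofReal_mul_I]

theorem torusMap_zero_apply_ne_zero (hR : ∀ i, R i ≠ 0) (θ : Fin q → ℝ) (i : Fin q) :
    torusMap 0 R θ i ≠ 0 :=
  norm_ne_zero_iff.1 <| by rw [norm_torusMap_zero_apply]; exact abs_ne_zero.2 (hR i)

theorem torusIntegrable_of_continuousOn {E : Type*} [NormedAddCommGroup E] {f : (Fin q → ℂ) → E}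
    {U : Set (Fin q → ℂ)} (hf : ContinuousOn f U) (hU : ∀ θ, torusMap c R θ ∈ U) :
    TorusIntegrable f c R :=
  (hf.comp_continuous (continuous_torusMap c R) hU).integrableOn_Icc

variable {E : Type*} [NormedAddCommGroup E] [NormedSpace ℂ E]

theorem torusIntegral_congr {f g : (Fin q → ℂ) → E} {U : Set (Fin q → ℂ)} (h : Set.EqOn f g U)
    (hU : ∀ θ, torusMap c R θ ∈ U) : torusIntegral f c R = torusIntegral g c R := by
  simp only [torusIntegral, h (hU _)]

theorem torusIntegral_finsetSum {ι : Type*} (s : Finset ι) {f : ι → (Fin q → ℂ) → E}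
    (h : ∀ i ∈ s, TorusIntegrable (f i) c R) :
    torusIntegral (fun y => ∑ i ∈ s, f i y) c R = ∑ i ∈ s, torusIntegral (f i) c R := by
  simp only [torusIntegral, Finset.smul_sum]
  exact MeasureTheory.integral_finsetSum s fun i hi => (h i hi).function_integrable

theorem hasSum_torusIntegral [CompleteSpace E] {ι : Type*} [Countable ι]
    {f : ι → (Fin q → ℂ) → E} {u : ι → ℝ} (hf : ∀ i, TorusIntegrable (f i) c R)
    (hfu : ∀ i θ, ‖f i (torusMap c R θ)‖ ≤ u i) (hu : Summable u) :
    HasSum (fun i => torusIntegral (f i) c R) (torusIntegral (fun y => ∑' i, f i y) c R) := by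
  have hbound : ∀ i (θ : Fin q → ℝ), ‖(∏ j, (R j : ℂ) * Complex.exp (θ j * Complex.I) * Complex.I) •
      f i (torusMap c R θ)‖ ≤ (∏ j, |R j|) * u i := fun i θ => by
    rw [norm_smul]
    refine (mul_le_mul_of_nonneg_left (hfu i θ) (norm_nonneg _)).trans_eq ?_
    simp
  refine MeasureTheory.hasSum_integral_of_dominated_convergence (fun i _ => (∏ j, |R j|) * u i)
    (fun i => (hf i).function_integrable.aestronglyMeasurable) (fun i => .of_forall (hbound i))
    (.of_forall fun _ => hu.mul_left _) ?_ (.of_forall fun θ => ?_)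
  · exact MeasureTheory.integrableOn_const (by simp [measure_Icc_lt_top.ne])
  · exact (Summable.of_norm_bounded hu fun i => hfu i θ).hasSum.const_smul _

theorem hasSum_torusIntegral_mul {ι κ : Type*} [Countable ι] [Countable κ]
    {f : ι → (Fin q → ℂ) → ℂ} {g : κ → (Fin q → ℂ) → ℂ} {u : ι → ℝ} {v : κ → ℝ}
    (hfg : ∀ i j, TorusIntegrable (fun y => f i y * g j y) c R)
    (hfu : ∀ i θ, ‖f i (torusMap c R θ)‖ ≤ u i) (hu : Summable u)
    (hgv : ∀ j θ, ‖g j (torusMap c R θ)‖ ≤ v j) (hv : Summable v) :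
    HasSum (fun a : ι × κ => torusIntegral (fun y => f a.1 y * g a.2 y) c R)
      (torusIntegral (fun y => (∑' i, f i y) * ∑' j, g j y) c R) := by
  have hu0 : ∀ i, 0 ≤ u i := fun i => (norm_nonneg _).trans (hfu i 0)
  have hv0 : ∀ j, 0 ≤ v j := fun j => (norm_nonneg _).trans (hgv j 0)
  have htsum : Set.EqOn (fun y => (∑' i, f i y) * ∑' j, g j y)
      (fun y => ∑' a : ι × κ, f a.1 y * g a.2 y) (Set.range (torusMap c R)) := by
    rintro _ ⟨θ, rfl⟩
    exact tsum_mul_tsum_of_summable_norm (.of_nonneg_of_le (fun _ => norm_nonneg _) (hfu · θ) hu)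
      (.of_nonneg_of_le (fun _ => norm_nonneg _) (hgv · θ) hv)
  rw [torusIntegral_congr htsum Set.mem_range_self]
  exact hasSum_torusIntegral (fun a : ι × κ => hfg a.1 a.2)
    (fun a θ => norm_mul_le_of_le (hfu a.1 θ) (hgv a.2 θ)) (hu.mul_of_nonneg hv hu0 hv0)

theorem torusIntegral_prod (f : Fin q → ℂ → ℂ) (c : Fin q → ℂ) (R : Fin q → ℝ) :
    torusIntegral (fun y => ∏ i, f i (y i)) c R = ∏ i, circleIntegral (f i) (c i) (R i) := by
  have hIcc : (Set.Icc (0 : Fin q → ℝ) fun _ => 2 * Real.pi) =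
      Set.univ.pi fun _ => Set.Icc 0 (2 * Real.pi) := (Set.pi_univ_Icc _ _).symm
  simp only [torusIntegral, circleIntegral_def_Icc, smul_eq_mul, ← Finset.prod_mul_distrib,
    hIcc, MeasureTheory.volume_pi, MeasureTheory.Measure.restrict_pi_pi, deriv_circleMap,
    torusMap, circleMap, zero_add]
  exact MeasureTheory.integral_fintype_prod_eq_prod (E := fun _ : Fin q => ℝ)
    (μ := fun _ => MeasureTheory.volume.restrict (Set.Icc 0 (2 * Real.pi))) fun i (θ : ℝ) =>
      (R i : ℂ) * Complex.exp (θ * Complex.I) * Complex.I *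
        f i (c i + R i * Complex.exp (θ * Complex.I))

theorem torusIntegral_prod_zpow (e : Fin q → ℤ) (hR : ∀ i, R i ≠ 0) :
    torusIntegral (fun y => ∏ i, y i ^ e i) 0 R =
      if ∀ i, e i = -1 then (2 * (Real.pi : ℂ) * Complex.I) ^ q else 0 := by
  rw [torusIntegral_prod fun i z => z ^ e i]
  split_ifs with h
  · have hcircle : ∀ i, circleIntegral (fun z => z ^ e i) 0 (R i) = 2 * (Real.pi : ℂ) * Complex.I :=
      fun i => by simpa [h i] using circleIntegral.integral_sub_center_inv 0 (hR i)
    simp [hcircle]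
  · obtain ⟨i, hi⟩ := not_forall.1 h
    refine Finset.prod_eq_zero (Finset.mem_univ i) ?_
    simpa using circleIntegral.integral_sub_zpow_of_ne hi 0 0 (R i)

end TorusIntegral

section Orthogonality

variable {q : ℕ}

theorem eq_and_eq_of_strictAnti_of_comp_perm_eq {α : Type*} [PartialOrder α] {f g : Fin q → α}
    (hf : StrictAnti f) (hg : StrictAnti g) {σ τ : Equiv.Perm (Fin q)} (h : f ∘ σ = g ∘ τ) :
    f = g ∧ σ = τ := by
  have hcomp : f ∘ ⇑(σ * τ⁻¹) = g := funext fun i => by simpa using congrFun h (τ⁻¹ i)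
  have hfg : f = g := by
    rw [← hcomp]
    exact Tuple.unique_antitone (σ := 1) hf.antitone (hcomp ▸ hg.antitone)
  refine ⟨hfg, Equiv.ext fun i => hf.injective ?_⟩
  simpa only [hfg, Function.comp_apply] using congrFun h i

theorem strictAnti_add_rev {s : Fin q → ℕ} (hs : Antitone s) :
    StrictAnti fun i => s i + (Fin.rev i : ℕ) := fun _ _ h =>
  add_lt_add_of_le_of_lt (hs h.le) (Fin.rev_lt_rev.2 h)

theorem prod_inv_mul_alternant_mul_alternant_inv {𝕜 : Type*} [Field 𝕜] (s s' : Fin q → ℕ)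
    {y : Fin q → 𝕜} (hy : ∀ i, y i ≠ 0) :
    (∏ i, (y i)⁻¹) * (alternant s y * alternant s' y⁻¹) =
      ∑ p : Equiv.Perm (Fin q) × Equiv.Perm (Fin q),
        ((Equiv.Perm.sign p.1 : ℤ) : 𝕜) * ((Equiv.Perm.sign p.2 : ℤ) : 𝕜) *
          ∏ i, y i ^ (((s (p.1 i) + Fin.rev (p.1 i) : ℕ) : ℤ) -
            (s' (p.2 i) + Fin.rev (p.2 i) : ℕ) - 1) := by
  simp only [alternant, Matrix.det_apply', Matrix.of_apply]
  rw [Finset.sum_mul_sum, ← Fintype.sum_prod_type', Finset.mul_sum]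
  refine Finset.sum_congr rfl fun p _ => ?_
  simp only [zpow_sub₀ (hy _), zpow_natCast, zpow_one, Finset.prod_div_distrib,
    Finset.prod_inv_distrib, Pi.inv_apply, inv_pow]
  ring

theorem torusIntegral_alternant_mul_alternant_inv {s s' : Fin q → ℕ} (hs : Antitone s)
    (hs' : Antitone s') {R : Fin q → ℝ} (hR : ∀ i, R i ≠ 0) :
    torusIntegral (fun y => (∏ i, (y i)⁻¹) * (alternant s y * alternant s' y⁻¹)) 0 R =
      if s = s' then q.factorial * (2 * (Real.pi : ℂ) * Complex.I) ^ q else 0 := by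
  have hexponent : ∀ σ τ : Equiv.Perm (Fin q),
      (∀ i, ((s (σ i) + Fin.rev (σ i) : ℕ) : ℤ) - (s' (τ i) + Fin.rev (τ i) : ℕ) - 1 = -1) ↔
        s = s' ∧ σ = τ := fun σ τ => by
    refine ⟨fun h => ?_, fun ⟨h, hστ⟩ i => by rw [h, hστ]; ring⟩
    obtain ⟨hexp, hστ⟩ := eq_and_eq_of_strictAnti_of_comp_perm_eq (strictAnti_add_rev hs)
      (strictAnti_add_rev hs') (σ := σ) (τ := τ) (funext fun i => by
        have := h i
        simp only [Function.comp_apply]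
        omega)
    exact ⟨funext fun i => Nat.add_right_cancel (congrFun hexp i), hστ⟩
  have hsign : ∀ σ : Equiv.Perm (Fin q),
      ((Equiv.Perm.sign σ : ℤ) : ℂ) * ((Equiv.Perm.sign σ : ℤ) : ℂ) = 1 := fun σ => by
    rw [← Int.cast_mul, ← Units.val_mul, Int.units_mul_self, Units.val_one, Int.cast_one]
  have hintegrable : ∀ (a : ℂ) (e : Fin q → ℤ),
      TorusIntegrable (fun y => a * ∏ i, y i ^ e i) 0 R := fun a e =>
    torusIntegrable_of_continuousOn (U := {y | ∀ i, y i ≠ 0})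
      (continuousOn_const.mul <| continuousOn_finsetProd _ fun i _ =>
        (continuousOn_apply i _).zpow₀ _ fun y hy => .inl (hy i))
      (torusMap_zero_apply_ne_zero hR)
  rw [torusIntegral_congr (U := {y | ∀ i, y i ≠ 0})
      (fun y hy => prod_inv_mul_alternant_mul_alternant_inv s s' hy)
      (torusMap_zero_apply_ne_zero hR),
    torusIntegral_finsetSum _ fun _ _ => hintegrable _ _]
  simp only [torusIntegral_const_mul, torusIntegral_prod_zpow _ hR, hexponent,
    Fintype.sum_prod_type]
  split_ifs with h
  · simp [h, hsign, Fintype.card_perm]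
  · simp [h]

end Orthogonality

section AlternantPairing

variable {q : ℕ}

theorem mul_norm_pi_lt_one {ι : Type*} [Fintype ι] {a : ℝ} (ha : 0 ≤ a) {R : ι → ℝ}
    (h : ∀ i, a * |R i| < 1) : a * ‖R‖ < 1 := by
  rw [← Real.norm_of_nonneg ha, ← norm_smul]
  refine (pi_norm_lt_iff one_pos).2 fun i => ?_
  rw [Pi.smul_apply, norm_smul, Real.norm_of_nonneg ha]
  exact h i

theorem norm_prod_inv_mul_pow_card_mul_alternant_le {g : PartitionLE q → ℂ} {C : ℝ}
    (hg : ∀ μ, ‖g μ‖ ≤ C) (t : ℂ) {r : ℝ} {y : Fin q → ℂ} (hy : ∀ i, 1 ≤ ‖y i‖)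
    (hyr : ∀ i, ‖y i‖ ≤ r) (μ : PartitionLE q) :
    ‖(∏ i, (y i)⁻¹) * (g μ * (t ^ μ.1.card * alternant (parts μ.1) y))‖ ≤
      C * (q.factorial * r ^ ∑ i : Fin q, (Fin.rev i : ℕ)) * (‖t‖ * r) ^ μ.1.card := by
  have hC : 0 ≤ C := (norm_nonneg _).trans (hg μ)
  have hprod : ‖∏ i, (y i)⁻¹‖ ≤ 1 := by
    rw [norm_prod]
    refine Finset.prod_le_one (fun _ _ => norm_nonneg _) fun i _ => ?_
    rw [norm_inv]
    exact inv_le_one_of_one_le₀ (hy i)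
  have halternant := norm_alternant_le (parts μ.1) hyr
  rw [Finset.sum_add_distrib, ← card_eq_sum_parts μ.2] at halternant
  calc ‖(∏ i, (y i)⁻¹) * (g μ * (t ^ μ.1.card * alternant (parts μ.1) y))‖
      = ‖∏ i, (y i)⁻¹‖ * (‖g μ‖ * (‖t‖ ^ μ.1.card * ‖alternant (parts μ.1) y‖)) := by
        simp only [norm_mul, norm_pow]
    _ ≤ 1 * (C * (‖t‖ ^ μ.1.card *
          (q.factorial * r ^ (μ.1.card + ∑ i : Fin q, (Fin.rev i : ℕ))))) := by
        gcongr
        exact hg μ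
    _ = C * (q.factorial * r ^ ∑ i : Fin q, (Fin.rev i : ℕ)) * (‖t‖ * r) ^ μ.1.card := by
        ring

theorem torusIntegrable_prod_inv_mul_mul_alternant_inv {f : (Fin q → ℂ) → ℂ} (hf : Continuous f)
    (s : Fin q → ℕ) {R : Fin q → ℝ} (hR : ∀ i, R i ≠ 0) :
    TorusIntegrable (fun y => (∏ i, (y i)⁻¹) * f y * alternant s y⁻¹) 0 R := by
  have hinv : ContinuousOn (fun y : Fin q → ℂ => y⁻¹) {y | ∀ i, y i ≠ 0} :=
    continuousOn_pi.2 fun i => (continuousOn_apply i _).inv₀ fun y hy => hy i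
  exact torusIntegrable_of_continuousOn (((continuousOn_finsetProd _ fun i _ =>
    continuousOn_pi.1 hinv i).mul hf.continuousOn).mul
      ((continuous_alternant s).comp_continuousOn hinv)) (torusMap_zero_apply_ne_zero hR)

theorem hasSum_torusIntegral_alternant_mul_alternant_inv {g : PartitionLE q → ℂ} {C : ℝ}
    (hg : ∀ μ, ‖g μ‖ ≤ C) {t : ℂ} {R : Fin q → ℝ} (hR : ∀ i, 1 < R i) (ht : ∀ i, ‖t‖ * R i < 1) :
    HasSum (fun a : PartitionLE q × PartitionLE q => g a.1 * t ^ a.1.1.card *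
        torusIntegral (fun y => (∏ i, (y i)⁻¹) *
          (alternant (parts a.1.1) y * alternant (parts a.2.1) y⁻¹)) 0 R)
      (torusIntegral (fun y => (∏ i, (y i)⁻¹) *
        ((∑' μ : PartitionLE q, g μ * (t ^ μ.1.card * alternant (parts μ.1) y)) *
          ∑' ν : PartitionLE q, alternant (parts ν.1) y⁻¹)) 0 R) := by
  have habs : ∀ i, |R i| = R i := fun i => abs_of_pos (one_pos.trans (hR i))
  have hR0 : ∀ i, R i ≠ 0 := fun i => (one_pos.trans (hR i)).ne'
  have hinv : ‖R⁻¹‖ < 1 := (pi_norm_lt_iff one_pos).2 fun i => by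
    rw [Pi.inv_apply, norm_inv, Real.norm_eq_abs, habs]
    exact inv_lt_one_of_one_lt₀ (hR i)
  have hnorm_inv : ∀ θ i, ‖(torusMap 0 R θ)⁻¹ i‖ ≤ ‖R⁻¹‖ := fun θ i => by
    rw [Pi.inv_apply, norm_inv, norm_torusMap_zero_apply]
    simpa using norm_le_pi_norm R⁻¹ i
  have hsum := hasSum_torusIntegral_mul (fun μ ν : PartitionLE q =>
      torusIntegrable_prod_inv_mul_mul_alternant_inv
        (continuous_const.mul (continuous_const.mul (continuous_alternant _))) _ hR0)
    (fun μ θ => norm_prod_inv_mul_pow_card_mul_alternant_le hg t (r := ‖R‖)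
      (fun i => by rw [norm_torusMap_zero_apply, habs]; exact (hR i).le)
      (fun i => by rw [norm_torusMap_zero_apply]; exact norm_le_pi_norm R i) μ)
    ((summable_pow_card q (by positivity) (mul_norm_pi_lt_one (norm_nonneg t) fun i => by
      rw [habs]; exact ht i)).mul_left _)
    (fun ν θ => by
      rw [card_eq_sum_parts ν.2]
      exact norm_alternant_le_of_le_one (parts ν.1) (hnorm_inv θ) hinv.le)
    ((summable_pow_card q (norm_nonneg _) hinv).mul_left _)
  simp only [Pi.mul_apply, tsum_mul_left, mul_assoc] at hsum ⊢
  refine hsum.congr_fun fun a => ?_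
  simp only [← torusIntegral_const_mul]
  congr with y
  ring

theorem torusIntegral_tsum_alternant_mul_tsum_alternant_inv {g : PartitionLE q → ℂ} {C : ℝ}
    (hg : ∀ μ, ‖g μ‖ ≤ C) {t : ℂ} {R : Fin q → ℝ} (hR : ∀ i, 1 < R i) (ht : ∀ i, ‖t‖ * R i < 1) :
    torusIntegral (fun y => (∏ i, (y i)⁻¹) *
        ((∑' μ : PartitionLE q, g μ * (t ^ μ.1.card * alternant (parts μ.1) y)) *
          ∑' ν : PartitionLE q, alternant (parts ν.1) y⁻¹)) 0 R =
      q.factorial * (2 * (Real.pi : ℂ) * Complex.I) ^ q *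
        ∑' μ : PartitionLE q, g μ * t ^ μ.1.card := by
  have hsum := hasSum_torusIntegral_alternant_mul_alternant_inv hg hR ht
  classical
  have hparts : ∀ μ ν : PartitionLE q, (parts μ.1 : Fin q → ℕ) = parts ν.1 ↔ ν = μ :=
    fun μ ν => (parts_injective q).eq_iff.trans eq_comm
  rw [← hsum.tsum_eq, hsum.summable.tsum_prod, ← tsum_mul_left]
  refine tsum_congr fun μ => ?_
  simp only [torusIntegral_alternant_mul_alternant_inv (antitone_parts _) (antitone_parts _)
    fun i => (one_pos.trans (hR i)).ne', hparts, tsum_mul_left]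
  rw [tsum_ite_eq, mul_comm]

end AlternantPairing

section TorusIntegrand

theorem sum_val_rev (q : ℕ) : ∑ i : Fin q, (Fin.rev i : ℕ) = q.choose 2 :=
  (Equiv.sum_comp Fin.revPerm fun i : Fin q => (i : ℕ)).trans <| by
    rw [Fin.sum_univ_eq_sum_range (fun i => i) q, Finset.sum_range_id, Nat.choose_two_right]

theorem inv_sub_inv_div_one_sub_inv_mul_inv {K : Type*} [Field K] {a b : K} (ha : a ≠ 0)
    (hb : b ≠ 0) : (a⁻¹ - b⁻¹) / (1 - a⁻¹ * b⁻¹) = -1 * ((a - b) / (a * b - 1)) := by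
  rw [← mul_div_mul_left _ _ (mul_ne_zero ha hb), ← mul_div_assoc]
  congr 1 <;> field_simp
  ring

theorem prod_inv_mul_littlewoodProd_inv {K : Type*} [Field K] {q : ℕ}
    {y : Fin q → K} (hy : ∀ i, y i ≠ 0) :
    (∏ i, (y i)⁻¹) * littlewoodProd y⁻¹ = (-1) ^ q.choose 2 *
      ((∏ i, (y i - 1)⁻¹) * ∏ i, ∏ j ∈ Finset.Ioi i, (y i - y j) / (y i * y j - 1)) := by
  have hdiag : ∀ i, (y i)⁻¹ * (1 - (y i)⁻¹)⁻¹ = (y i - 1)⁻¹ := fun i => by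
    rw [← mul_inv, mul_sub, mul_one, mul_inv_cancel₀ (hy i)]
  simp only [littlewoodProd, Pi.inv_apply, inv_sub_inv_div_one_sub_inv_mul_inv (hy _) (hy _),
    Finset.prod_mul_distrib, prod_prod_Ioi_const, sum_val_rev, ← hdiag]
  ring

variable {m q : ℕ} {x : Fin m → ℂ} {t : ℂ}

theorem torusIntegrand_eq (x : Fin m → ℂ) (t : ℂ) {y : Fin q → ℂ} (hy : ∀ i, y i ≠ 0) :
    torusIntegrand x t y = (-1) ^ q.choose 2 * ((∏ i, (y i)⁻¹) *
      (((∏ i, ∏ j, (1 - x i * (t * y j))⁻¹) * ((∏ i, (1 - t * y i)⁻¹) *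
        ∏ i, ∏ j ∈ Finset.Ioi i, (y i - y j) / (1 - t * y i * (t * y j)))) *
        littlewoodProd y⁻¹)) := by
  have hsign : ((-1 : ℂ) ^ q.choose 2) * (-1) ^ q.choose 2 = 1 := pow_mul_pow_eq_one _ (by simp)
  have hassoc : ∀ a b : ℂ, t ^ 2 * a * b = t * a * (t * b) := fun a b => by ring
  rw [mul_left_comm (∏ i, (y i)⁻¹), prod_inv_mul_littlewoodProd_inv hy, mul_left_comm _ (_ ^ _),
    ← mul_assoc, hsign, one_mul]
  simp only [torusIntegrand, hassoc, mul_assoc (x _), sq (_ - _), div_eq_mul_inv, one_mul,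
    Finset.prod_mul_distrib]
  ring

theorem sub_one_ne_zero_of_one_lt_norm {z : ℂ} (hz : 1 < ‖z‖) : z - 1 ≠ 0 :=
  sub_ne_zero.2 fun h => by simp [h] at hz

theorem continuousOn_torusIntegrand (hx : ∀ i, ‖x i‖ < 1) :
    ContinuousOn (torusIntegrand x t : (Fin q → ℂ) → ℂ)
      {y | ∀ i, 1 < ‖y i‖ ∧ ‖t * y i‖ < 1} := by
  have hmul : ∀ {a b : ℂ}, ‖a‖ < 1 → ‖b‖ < 1 → 1 - a * b ≠ 0 := fun ha hb =>
    one_sub_ne_zero_of_norm_lt_one ((norm_mul _ _).trans_lt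
      (mul_lt_one_of_nonneg_of_lt_one_left (norm_nonneg _) ha hb.le))
  refine ((((ContinuousOn.mul ?_ ?_).mul ?_).mul ?_).mul ?_) <;>
    refine continuousOn_finsetProd _ fun i _ => ?_
  · refine continuousOn_finsetProd _ fun j _ => .div (by fun_prop) (by fun_prop) fun y hy => ?_
    have h := hmul (hy i).2 (hy j).2
    ring_nf at h ⊢
    exact h
  · refine continuousOn_finsetProd _ fun j _ => .div (by fun_prop) (by fun_prop) fun y hy => ?_
    rw [mul_assoc]
    exact hmul (hx i) (hy j).2
  · exact .div (by fun_prop) (by fun_prop) fun y hy => one_sub_ne_zero_of_norm_lt_one (hy i).2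
  · exact .div (by fun_prop) (by fun_prop) fun y hy => sub_one_ne_zero_of_one_lt_norm (hy i).1
  · refine continuousOn_finsetProd _ fun j _ => .div (by fun_prop) (by fun_prop) fun y hy =>
      sub_one_ne_zero_of_one_lt_norm ?_
    rw [norm_mul]
    exact one_lt_mul_of_lt_of_le (hy i).1 (hy j).1.le

theorem torusMap_zero_apply_mem {R : Fin q → ℝ} (hR : ∀ i, 1 < R i) (ht : ∀ i, ‖t‖ * R i < 1)
    (θ : Fin q → ℝ) : torusMap 0 R θ ∈ {y : Fin q → ℂ | ∀ i, 1 < ‖y i‖ ∧ ‖t * y i‖ < 1} :=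
  fun i => by
    rw [norm_mul, norm_torusMap_zero_apply, abs_of_pos (one_pos.trans (hR i))]
    exact ⟨hR i, ht i⟩

theorem torusIntegrable_torusIntegrand (hx : ∀ i, ‖x i‖ < 1) {R : Fin q → ℝ} (hR : ∀ i, 1 < R i)
    (ht : ∀ i, ‖t‖ * R i < 1) : TorusIntegrable (torusIntegrand x t) 0 R :=
  torusIntegrable_of_continuousOn (continuousOn_torusIntegrand hx) (torusMap_zero_apply_mem hR ht)

theorem schurProd_mul_torusIntegral_torusIntegrand (hx : ∀ i, ‖x i‖ < 1) {R : Fin q → ℝ}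
    (hR : ∀ i, 1 < R i) (ht : ∀ i, ‖t‖ * R i < 1) :
    schurProd x * torusIntegral (torusIntegrand x t) 0 R = (-1) ^ q.choose 2 *
      (q.factorial * (2 * (Real.pi : ℂ) * Complex.I) ^ q *
        ∑' μ : PartitionLE q, outerSkewSum x μ.1 * t ^ μ.1.card) := by
  obtain ⟨C, hC⟩ := exists_norm_outerSkewSum_le hx q
  rw [← torusIntegral_tsum_alternant_mul_tsum_alternant_inv hC hR ht, ← torusIntegral_const_mul,
    ← torusIntegral_const_mul]
  refine torusIntegral_congr (fun y hy => ?_) (torusMap_zero_apply_mem hR ht)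
  have hinv : ∀ i, ‖y⁻¹ i‖ < 1 := fun i => by
    rw [Pi.inv_apply, norm_inv]
    exact inv_lt_one_of_one_lt₀ (hy i).1
  simp only [torusIntegrand_eq x t fun i => norm_pos_iff.1 (one_pos.trans (hy i).1),
    tsum_outerSkewSum_mul_pow_card_mul_alternant hx fun i => (hy i).2, tsum_alternant hinv]
  ring

theorem tsum_outerSkewSum_mul_pow_card (hx : ∀ i, ‖x i‖ < 1) {R : Fin q → ℝ}
    (hR : ∀ i, 1 < R i) (ht : ∀ i, ‖t‖ * R i < 1) :
    ∑' μ : PartitionLE q, outerSkewSum x μ.1 * t ^ μ.1.card =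
      (-1) ^ q.choose 2 / q.factorial * schurProd x *
        (1 / (2 * (Real.pi : ℂ) * Complex.I) ^ q * torusIntegral (torusIntegrand x t) 0 R) := by
  have hsign : ((-1 : ℂ) ^ q.choose 2) * (-1) ^ q.choose 2 = 1 := pow_mul_pow_eq_one _ (by simp)
  have hfactorial : (q.factorial : ℂ) ≠ 0 := Nat.cast_ne_zero.2 q.factorial_ne_zero
  have hpi : (2 * (Real.pi : ℂ) * Complex.I) ^ q ≠ 0 := pow_ne_zero _ Complex.two_pi_I_ne_zero
  calc ∑' μ : PartitionLE q, outerSkewSum x μ.1 * t ^ μ.1.card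
      = (-1) ^ q.choose 2 * (-1) ^ q.choose 2 *
          ∑' μ : PartitionLE q, outerSkewSum x μ.1 * t ^ μ.1.card := by rw [hsign, one_mul]
    _ = (-1) ^ q.choose 2 / (q.factorial * (2 * (Real.pi : ℂ) * Complex.I) ^ q) *
          (schurProd x * torusIntegral (torusIntegrand x t) 0 R) := by
        rw [schurProd_mul_torusIntegral_torusIntegrand hx hR ht, mul_left_comm,
          ← mul_assoc (_ / _), div_mul_cancel₀ _ (mul_ne_zero hfactorial hpi), mul_assoc]
    _ = _ := by ring

end TorusIntegrand

section SchurSum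

theorem summable_skewSchurEval_mul_pow_card {𝕜 : Type*} [NormedField 𝕜] [CompleteSpace 𝕜] {l : ℕ}
    {x : Fin l → 𝕜} (hx : ∀ i, ‖x i‖ < 1) {t : 𝕜} (ht : ‖t‖ < 1) (q : ℕ) :
    Summable fun a : PartitionLE q × YoungDiagram =>
      skewSchurEval a.2 a.1.1 x * t ^ a.1.1.card := by
  obtain ⟨B, hB, hle⟩ := exists_tsum_enorm_skewSchurEval_le hx q
  have hpow : ∑' μ : PartitionLE q, ‖t ^ μ.1.card‖ₑ ≠ ⊤ := by
    simpa only [tsum_enorm_ne_top_iff_summable_norm, norm_pow] using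
      summable_pow_card q (norm_nonneg t) ht
  refine .of_enorm (ne_top_of_le_ne_top (ENNReal.mul_ne_top hB hpow) ?_)
  simp only [ENNReal.tsum_prod', enorm_mul, ENNReal.tsum_mul_right]
  rw [← ENNReal.tsum_mul_left]
  exact ENNReal.tsum_le_tsum fun μ => mul_le_mul_left (hle μ) _

theorem hasSum_schurTerm {n k : ℕ} (hk : k + 1 ≤ n) {x : Fin (n - k - 1) → ℂ}
    (hx : ∀ i, ‖x i‖ < 1) {t : ℂ} (ht : ‖t‖ < 1) :
    HasSum (schurTerm n k x t)
      (∑' μ : PartitionLE (k + 1), outerSkewSum x μ.1 * t ^ μ.1.card) := by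
  let e : PartPair n k → PartitionLE (k + 1) × YoungDiagram := fun p => (⟨p.1.2, p.2.2⟩, p.1.1)
  have he : Function.Injective e := fun p p' h => by
    rw [Prod.mk.injEq, Subtype.mk.injEq] at h
    exact Subtype.ext (Prod.ext h.2 h.1)
  have hsum := summable_skewSchurEval_mul_pow_card hx ht (k + 1)
  have htsum : ∑' a : PartitionLE (k + 1) × YoungDiagram,
      skewSchurEval a.2 a.1.1 x * t ^ a.1.1.card =
      ∑' μ : PartitionLE (k + 1), outerSkewSum x μ.1 * t ^ μ.1.card := by
    simp only [hsum.tsum_prod, tsum_mul_right, outerSkewSum]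
  rw [← htsum]
  refine (he.hasSum_iff fun a ha => ?_).2 hsum.hasSum
  rw [skewSchurEval_eq_zero_of_lt_partLength x, zero_mul]
  refine not_le.1 fun hle => ?_
  have hlam : partLength a.2 ≤ n := by
    have := a.1.2
    omega
  exact ha ⟨⟨(a.2, a.1.1), hlam, a.1.2⟩, rfl⟩

end SchurSum

theorem mainTheorem9 (n k : ℕ) (hk : k + 1 ≤ n) (x : Fin (n - k - 1) → ℂ) (t : ℂ)
    (hx : ∀ i, ‖x i‖ < 1) (ε : Fin (k + 1) → ℝ) (hε : ∀ i, 0 < ε i)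
    (ht : ∀ i, ‖t‖ * (1 + ε i) < 1) :
    Summable (schurTerm n k x t) ∧
    TorusIntegrable (torusIntegrand x t) (0 : Fin (k + 1) → ℂ) (fun i => 1 + ε i) ∧
    schurSum n k x t =
      (-1) ^ ((k + 1).choose 2) / ((k + 1).factorial : ℂ) *
      (∏ i, 1 / (1 - x i)) *
      (∏ i, ∏ j ∈ Finset.Ioi i, 1 / (1 - x i * x j)) *
      (1 / (2 * (Real.pi : ℂ) * Complex.I) ^ (k + 1) *
        torusIntegral (torusIntegrand x t) (0 : Fin (k + 1) → ℂ) (fun i => 1 + ε i)) := by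
  have hR : ∀ i, 1 < 1 + ε i := fun i => lt_add_of_pos_right 1 (hε i)
  have ht1 : ‖t‖ < 1 := (le_mul_of_one_le_right (norm_nonneg t) (hR 0).le).trans_lt (ht 0)
  have hsum := hasSum_schurTerm hk hx ht1
  refine ⟨hsum.summable, torusIntegrable_torusIntegrand hx hR ht, ?_⟩
  rw [schurSum, hsum.tsum_eq, tsum_outerSkewSum_mul_pow_card hx hR ht]
  simp only [schurProd, one_div, mul_assoc]
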